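/- Let $d,d',T\ge 1$ be integers, let $A\in\mathbb R^{d\times d}$ be nonsingular, $B\in\mathbb R^{d\times d'}$, $\gamma,\varepsilon>0$, and let $\alpha=c_\alpha\,\mathcal N(m_\alpha,\Sigma_\alpha)$, $\beta=c_\beta\,\mathcal N(m_\beta,\Sigma_\beta)$ be Gaussian measures on $\mathbb R^d$ with $c_\alpha,c_\beta>0$ and $\Sigma_\alpha,\Sigma_\beta\succ 0$. For a measure $\pi_1$ on $\mathbb R^d$ and Markov kernels $U_t(du|x)$ from $\mathbb R^d$ to $\mathbb R^{d'}$, $t=1,\dots,T-1$, define the state measures recursively by $$\pi_{t+1}=(Ax+Bu)_\#\bigl(\pi_t(dx)\,U_t(du|x)\bigr),\qquad t=1,\dots,T-1 .$$ The pair $(\pi_1,\{U_t\}_{t=1}^{T-1})$ is called feasible if every $\pi_t$, $t=1,\dots,T$, is a finite measure with finite second moment and $\sum_{t=1}^{T-1}\iint\|u\|^2\,U_t(du|x)\,\pi_t(dx)<\infty$. For a finite measure $\mu$, let $$\mathrm{KL}(\mu\|\nu)=\int\log\frac{d\mu}{d\nu}\,d\mu+\nu(\mathbb R^d)-\mu(\mathbb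 R^d)\ \text{ if }\mu\ll\nu,\qquad \mathrm{KL}(\mu\|\nu)=+\infty\ \text{ otherwise.}$$ The entropy of a probability measure with Lebesgue density $p$ is $H=-\int p\log p$, and $H=-\infty$ if there is no density. The MaxEnt objective is $$J_4(\pi_1,\{U_t\})=\sum_{t=1}^{T-1}\iint\|u\|^2\,U_t(du|x)\,\pi_t(dx)+\gamma\,\mathrm{KL}(\pi_1\|\alpha)+\gamma\,\mathrm{KL}(\pi_T\|\beta)-\varepsilon\sum_{t=1}^{T-1}\int H\bigl(U_t(\cdot|x)\bigr)\,\pi_t(dx).$$ Let $(\pi_1,\{U_t\})$ be feasible with $\pi_1\neq0$, and let $c=\pi_1(\mathbb R^d)>0$. Let $m_t,\Sigma_t$ be the mean and covariance of $\pi_t/c$. For $t\le T-1$, let $\bar u_t$, $\Sigma_t^u$ and $\Lambda_t=\mathrm{Cov}(u_t,x_t)$ be the mean of $u_t$, the covariance of $u_t$ and the cross-covariance under $p_t(dx,du)=c^{-1}U_t(du|x)\,\pi_t(dx)$. With $\Sigma_t^\dagger$ the Moore–Penrose inverse, put $$\pi_1^{G}=c\,\mathcal N(m_1,\Sigma_1),\qquad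 U_t^{G}(\cdot|x)=\mathcal N\bigl(\bar u_t+\Lambda_t\Sigma_t^\dagger(x-m_t),\ \Sigma_t^u-\Lambda_t\Sigma_t^\dagger\Lambda_t^\top\bigr),$$ and let $\pi_t^G$ be the state measures of $(\pi_1^G,\{U_t^G\})$. **Theorem (Gaussian reduction for MaxEnt UDC).** The pair $(\pi_1^G,\{U_t^G\})$ is feasible; for every $t=1,\dots,T-1$, $$\int H\bigl(U_t(\cdot|x)\bigr)\,\pi_t(dx)\ \le\ \int H\bigl(U_t^G(\cdot|x)\bigr)\,\pi_t^G(dx)\ <\ +\infty ;$$ and $$J_4\bigl(\pi_1^{G},\{U_t^{G}\}\bigr)\ \le\ J_4\bigl(\pi_1,\{U_t\}\bigr).$$ (Objectives and expected entropies are extended real valued.) -/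

import Mathlib

open MeasureTheory ProbabilityTheory InformationTheory Matrix
open scoped ENNReal

noncomputable section

namespace UDC

/-- `ℝⁿ` with the Euclidean norm. -/
abbrev E (n : ℕ) : Type := EuclideanSpace ℝ (Fin n)

/-- The matrix-vector product `M x` as a map between Euclidean spaces. -/
def act {m n : ℕ} (M : Matrix (Fin m) (Fin n) ℝ) (x : E n) : E m :=
  WithLp.toLp 2 (M *ᵥ x.ofLp)

lemma measurable_act {m n : ℕ} (M : Matrix (Fin m) (Fin n) ℝ) : Measurable (act M) := by
  have h : Continuous (act M) := by
    unfold act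
    fun_prop
  exact h.measurable

/-! ### Moore-Penrose inverse -/

/-- The four Penrose equations: `Y` is the Moore-Penrose inverse of the real matrix `X`. -/
structure IsMoorePenrose {n : ℕ} (X Y : Matrix (Fin n) (Fin n) ℝ) : Prop where
  mul_mul_left : X * Y * X = X
  mul_mul_right : Y * X * Y = Y
  symm_left : (X * Y)ᵀ = X * Y
  symm_right : (Y * X)ᵀ = Y * X

/-- The Moore-Penrose inverse `X† = (Xᵀ X)† Xᵀ`, where the symmetric matrix `Xᵀ X` is inverted
spectrally (the functional calculus of `r ↦ r⁻¹`, with `0⁻¹ = 0`). -/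
def pinv {n : ℕ} (X : Matrix (Fin n) (Fin n) ℝ) : Matrix (Fin n) (Fin n) ℝ :=
  cfc (fun r : ℝ => r⁻¹) (Xᵀ * X) * Xᵀ

lemma isMoorePenrose_pinv {n : ℕ} (X : Matrix (Fin n) (Fin n) ℝ) :
    IsMoorePenrose X (pinv X) := by
  have hS : IsSelfAdjoint (Xᵀ * X) := by
    have := Matrix.isHermitian_conjTranspose_mul_self X
    rwa [conjTranspose_eq_transpose_of_trivial] at this
  set S := Xᵀ * X with hSdef
  have hfin : (spectrum ℝ S).Finite := Matrix.finite_real_spectrum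
  have hc : ∀ f : ℝ → ℝ, ContinuousOn f (spectrum ℝ S) := fun f => hfin.continuousOn f
  have hid : cfc (fun r : ℝ => r) S = S := cfc_id' ℝ S
  set G := cfc (fun r : ℝ => r⁻¹) S with hG
  have hGS : G * S = cfc (fun r : ℝ => r⁻¹ * r) S := by
    conv_lhs => rw [← hid, hid, hG]
    nth_rewrite 2 [← hid]
    rw [← cfc_mul _ _ S (hc _) (hc _)]
  have hGsymm : Gᵀ = G := by
    have : IsSelfAdjoint G := cfc_predicate _ S
    have h2 : Gᴴ = G := this
    rwa [conjTranspose_eq_transpose_of_trivial] at h2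
  have hGSsymm : (G * S)ᵀ = G * S := by
    rw [hGS]
    have : IsSelfAdjoint (cfc (fun r : ℝ => r⁻¹ * r) S) := cfc_predicate _ S
    have h2 : (cfc (fun r : ℝ => r⁻¹ * r) S)ᴴ = cfc (fun r : ℝ => r⁻¹ * r) S := this
    rwa [conjTranspose_eq_transpose_of_trivial] at h2
  have hSsymm : Sᵀ = S := by rw [hSdef, transpose_mul, transpose_transpose]
  have hGSG : G * S * G = G := by
    rw [hGS, hG, ← cfc_mul _ _ S (hc _) (hc _)]
    congr 1
    funext r
    by_cases hr : r = 0
    · simp [hr]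
    · field_simp
  have hSGS : S * (G * S) = S := by
    rw [hGS]
    nth_rewrite 1 [← hid]
    rw [← cfc_mul _ _ S (hc _) (hc _)]
    conv_rhs => rw [← hid]
    congr 1
    funext r
    by_cases hr : r = 0
    · simp [hr]
    · field_simp
  have hXGS : X * (G * S) = X := by
    have h0 : (X * (G * S) - X)ᴴ * (X * (G * S) - X) = 0 := by
      have h1 : Xᵀ * (X * (G * S) - X) = 0 := by
        rw [mul_sub, ← mul_assoc, ← hSdef, hSGS, sub_self]
      have h2 : (X * (G * S) - X)ᴴ = ((G * S)ᵀ - 1) * Xᵀ := by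
        rw [conjTranspose_eq_transpose_of_trivial, transpose_sub, transpose_mul X, sub_mul,
          one_mul]
      rw [h2, mul_assoc, h1, mul_zero]
    exact sub_eq_zero.mp (conjTranspose_mul_self_eq_zero.mp h0)
  have hp : pinv X = G * Xᵀ := rfl
  refine ⟨?_, ?_, ?_, ?_⟩
  · rw [hp, mul_assoc, mul_assoc, ← hSdef, hXGS]
  · rw [hp, mul_assoc G, ← hSdef, ← mul_assoc, hGSG]
  · rw [hp, transpose_mul, transpose_mul, transpose_transpose, hGsymm, mul_assoc]
  · rw [hp, mul_assoc, ← hSdef, hGSsymm]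

/-! ### Extended integrals and entropy -/

/-- The integral `∫ f⁺ dμ - ∫ f⁻ dμ` of an extended real function. When both parts are infinite
the value is `⊥` by convention. -/
def eintegral {X : Type*} [MeasurableSpace X] (μ : Measure X) (f : X → EReal) : EReal :=
  ((∫⁻ x, (f x).toENNReal ∂μ : ℝ≥0∞) : EReal) - ((∫⁻ x, (-f x).toENNReal ∂μ : ℝ≥0∞) : EReal)

open scoped Classical in
/-- Differential entropy `H(μ) = -∫ p log p` of a probability measure with Lebesgue density `p`,
and `-∞` for a measure without Lebesgue density. -/
def entropy {n : ℕ} (μ : Measure (E n)) : EReal :=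
  if μ ≪ volume then
    -eintegral volume (fun u =>
      (((μ.rnDeriv volume u).toReal * Real.log (μ.rnDeriv volume u).toReal : ℝ) : EReal))
  else ⊥

/-- The expected conditional entropy `𝔼[H(κ(·|x))] = ∫ H(κ(·|x)) dμ(x)`, for a finite measure `μ`.
It is written as minus the expectation of `-H`, so that an undefined integral would count as an
infinite reward. -/
def expectedEntropy {m n : ℕ} (μ : Measure (E m)) (κ : Kernel (E m) (E n)) : EReal :=
  -eintegral μ (fun x => -entropy (κ x))

/-! ### Dynamics and admissible pairs -/

section Dynamics

variable {d d' : ℕ}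

/-- The state measures `π_t` for `t ≥ 1`: `π_{t+1}` is the image of `π_t(dx) U_t(du|x)` under
`(x, u) ↦ A x + B u`. (Time starts at `1`; the value at `0` is not used.) -/
def stateMeasure (A : Matrix (Fin d) (Fin d) ℝ) (B : Matrix (Fin d) (Fin d') ℝ)
    (π₁ : Measure (E d)) (U : ℕ → Kernel (E d) (E d')) : ℕ → Measure (E d)
  | 0 => 0
  | 1 => π₁
  | t + 2 => ((stateMeasure A B π₁ U (t + 1)) ⊗ₘ (U (t + 1))).map
      (fun z => act A z.1 + act B z.2)

/-- Expected control energy `∑_{t=1}^{T-1} ∫ ∫ ‖u‖² U_t(du|x) π_t(dx)`. -/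
def controlCost (T : ℕ) (A : Matrix (Fin d) (Fin d) ℝ) (B : Matrix (Fin d) (Fin d') ℝ)
    (π₁ : Measure (E d)) (U : ℕ → Kernel (E d) (E d')) : ℝ≥0∞ :=
  ∑ t ∈ Finset.Ico 1 T, ∫⁻ x, ∫⁻ u, ‖u‖ₑ ^ 2 ∂(U t x) ∂(stateMeasure A B π₁ U t)

/-- The pair `(π₁, (U_t)_{1 ≤ t ≤ T-1})` is admissible (feasible): the `U_t` are Markov kernels,
the state measures `π_1, …, π_T` are finite with finite second moments, and the control energy
is finite. Only `U_t` with `1 ≤ t ≤ T-1` matter. -/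
structure Admissible (T : ℕ) (A : Matrix (Fin d) (Fin d) ℝ) (B : Matrix (Fin d) (Fin d') ℝ)
    (π₁ : Measure (E d)) (U : ℕ → Kernel (E d) (E d')) : Prop where
  markov : ∀ t ∈ Finset.Ico 1 T, IsMarkovKernel (U t)
  finite : ∀ t ∈ Finset.Icc 1 T, IsFiniteMeasure (stateMeasure A B π₁ U t)
  secondMoment : ∀ t ∈ Finset.Icc 1 T, ∫⁻ x, ‖x‖ₑ ^ 2 ∂(stateMeasure A B π₁ U t) < ∞
  energy : controlCost T A B π₁ U < ∞

/-! ### Objectives -/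

/-- The unbalanced density control objective
`𝔼[∑_{t=1}^{T-1} ‖u_t‖²] + γ KL(π_1 | α) + γ KL(π_T | β)`. Mathlib's `klDiv μ ν` is
`∫ log(dμ/dν) dμ + ν(ℝᵈ) - μ(ℝᵈ)`, or `∞` if `μ` is not absolutely continuous. -/
def udcObjective (T : ℕ) (A : Matrix (Fin d) (Fin d) ℝ) (B : Matrix (Fin d) (Fin d') ℝ)
    (γ : ℝ) (α β : Measure (E d))
    (π₁ : Measure (E d)) (U : ℕ → Kernel (E d) (E d')) : ℝ≥0∞ :=
  controlCost T A B π₁ U + ENNReal.ofReal γ * klDiv π₁ α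
    + ENNReal.ofReal γ * klDiv (stateMeasure A B π₁ U T) β

/-- The maximum-entropy objective: the previous one plus
`-ε 𝔼[∑_{t=1}^{T-1} H(U_t(·|x_t))]`. -/
def maxEntObjective (T : ℕ) (A : Matrix (Fin d) (Fin d) ℝ) (B : Matrix (Fin d) (Fin d') ℝ)
    (γ ε : ℝ) (α β : Measure (E d))
    (π₁ : Measure (E d)) (U : ℕ → Kernel (E d) (E d')) : EReal :=
  (udcObjective T A B γ α β π₁ U : EReal)
    - (ε : EReal) * ∑ t ∈ Finset.Ico 1 T, expectedEntropy (stateMeasure A B π₁ U t) (U t)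

/-! ### Moments and the Gaussian pair built from them -/

section Moments

variable (A : Matrix (Fin d) (Fin d) ℝ) (B : Matrix (Fin d) (Fin d') ℝ)
  (π₁ : Measure (E d)) (U : ℕ → Kernel (E d) (E d')) (t : ℕ)

/-- The normalized state law `π_t / c`, where `c = π_1(ℝᵈ)` is the total mass. -/
def stateLaw : Measure (E d) := (π₁ Set.univ)⁻¹ • stateMeasure A B π₁ U t

/-- The normalized joint law `p_t(dx, du) = c⁻¹ U_t(du|x) π_t(dx)`. -/
def jointLaw : Measure (E d × E d') := (π₁ Set.univ)⁻¹ • (stateMeasure A B π₁ U t ⊗ₘ U t)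

/-- State mean `m_t`. -/
def stateMean : E d := ∫ x, x ∂(stateLaw A B π₁ U t)

/-- State covariance `Σ_t`. -/
def stateCov : Matrix (Fin d) (Fin d) ℝ :=
  Matrix.of fun i j => covariance (fun x => x i) (fun x => x j) (stateLaw A B π₁ U t)

/-- Control mean `ū_t`. -/
def controlMean : E d' := ∫ z, z.2 ∂(jointLaw A B π₁ U t)

/-- Control covariance `Σ_t^u`. -/
def controlCov : Matrix (Fin d') (Fin d') ℝ :=
  Matrix.of fun i j => covariance (fun z => z.2 i) (fun z => z.2 j) (jointLaw A B π₁ U t)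

/-- Cross covariance `Λ_t = Cov(u_t, x_t)`. -/
def crossCov : Matrix (Fin d') (Fin d) ℝ :=
  Matrix.of fun i j => covariance (fun z => z.2 i) (fun z => z.1 j) (jointLaw A B π₁ U t)

end Moments

open scoped MatrixOrder in
/-- The affine-Gaussian kernel `x ↦ 𝒩(v + K (x - m), C)`. -/
def affineGaussianKernel (m : E d) (v : E d') (K : Matrix (Fin d') (Fin d) ℝ)
    (C : Matrix (Fin d') (Fin d') ℝ) : Kernel (E d) (E d') where
  toFun x := multivariateGaussian (v + act K (x - m)) C
  measurable' := by
    refine Measure.measurable_of_measurable_coe _ fun s hs => ?_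
    have hf : Measurable fun z : E d × E d' =>
        v + act K (z.1 - m) + toEuclideanCLM (𝕜 := ℝ)
          (CFC.sqrt C) z.2 := by
      have h1 : Measurable fun z : E d × E d' => act K (z.1 - m) :=
        (measurable_act K).comp (measurable_fst.sub_const m)
      have h2 : Measurable fun z : E d × E d' =>
          toEuclideanCLM (𝕜 := ℝ) (CFC.sqrt C) z.2 := by fun_prop
      exact (h1.const_add v).add h2
    have heq : (fun x : E d => multivariateGaussian (v + act K (x - m)) C s) = fun x : E d =>
        stdGaussian (E d') (Prod.mk x ⁻¹' ((fun z : E d × E d' =>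
          v + act K (z.1 - m) + toEuclideanCLM (𝕜 := ℝ) (CFC.sqrt C) z.2) ⁻¹' s)) := by
      funext x
      rw [multivariateGaussian, Measure.map_apply (by fun_prop) hs]
      rfl
    rw [heq]
    exact measurable_measure_prodMk_left (hf hs)

/-- The Gaussian initial measure `π_1^G = c 𝒩(m_1, Σ_1)`. -/
def gaussianInit (A : Matrix (Fin d) (Fin d) ℝ) (B : Matrix (Fin d) (Fin d') ℝ)
    (π₁ : Measure (E d)) (U : ℕ → Kernel (E d) (E d')) : Measure (E d) :=
  π₁ Set.univ • multivariateGaussian (stateMean A B π₁ U 1) (stateCov A B π₁ U 1)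

/-- The affine-Gaussian kernels
`U_t^G(·|x) = 𝒩(ū_t + Λ_t Σ_t† (x - m_t), Σ_t^u - Λ_t Σ_t† Λ_tᵀ)`. -/
def gaussianPolicy (A : Matrix (Fin d) (Fin d) ℝ) (B : Matrix (Fin d) (Fin d') ℝ)
    (π₁ : Measure (E d)) (U : ℕ → Kernel (E d) (E d')) (t : ℕ) : Kernel (E d) (E d') :=
  affineGaussianKernel (stateMean A B π₁ U t) (controlMean A B π₁ U t)
    (crossCov A B π₁ U t * pinv (stateCov A B π₁ U t))
    (controlCov A B π₁ U t
      - crossCov A B π₁ U t * pinv (stateCov A B π₁ U t) * (crossCov A B π₁ U t)ᵀ)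

end Dynamics

end UDC

end

/-! The Gaussian pair keeps every first and second moment, and at fixed moments a Gaussian is
optimal for the remaining terms.

Moments. With K = ΛΣ†, write u = ū + K(x − m) + w. The residual w is uncorrelated with x, even for
singular Σ, because a direction of zero state variance has zero covariance with u
(`regMat_mul_covMat`). The Gaussian policy keeps the affine part and replaces w by independent
Gaussian noise of the same covariance. So a linear image of (x, u) under the Gaussian pair is the
Gaussian with the original mean and covariance (`map_regression`). For Ax + Bu this gives all state
laws by induction (`stateMeasure_gaussian`); for u itself it gives equality of energies, hence
feasibility.

Divergences and entropies. Both come from Gibbs' inequality (`gibbs_pointwise`) with q a Gaussian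
log-density. Such a q is quadratic, so its integral sees only mean and covariance. For KL, q is the
log-density of the Gaussian relative to the reference (`klDiv_gaussian_le`). For entropy, q(x, ·) is
the log-density of the Gaussian policy at x: the entropy of U(·|x) is at most −∫ q(x, u) U(du|x),
and the average of this bound over x depends only on Cov(w), so it is the expected entropy of the
Gaussian policy (`expectedEntropy_le_of_posDef`).

Degenerate covariances. A law with singular covariance charges a Lebesgue-null hyperplane. A
singular state covariance makes the original KL infinite; a singular Cov(w) makes both expected
entropies −∞. -/

namespace UDC

/-! ### The linear maps `act M` -/

section Act

variable {k m n : ℕ}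

lemma act_apply (M : Matrix (Fin m) (Fin n) ℝ) (x : E n) (i : Fin m) :
    act M x i = ∑ j, M i j * x j := rfl

lemma act_add (M : Matrix (Fin m) (Fin n) ℝ) (x y : E n) :
    act M (x + y) = act M x + act M y := by
  ext i; simp [act_apply, mul_add, Finset.sum_add_distrib]

lemma act_sub (M : Matrix (Fin m) (Fin n) ℝ) (x y : E n) :
    act M (x - y) = act M x - act M y := by
  ext i; simp [act_apply, mul_sub, Finset.sum_sub_distrib]

lemma act_smul (M : Matrix (Fin m) (Fin n) ℝ) (c : ℝ) (x : E n) :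
    act M (c • x) = c • act M x := by
  ext i; simp [act_apply, Finset.mul_sum, mul_left_comm]

@[simp] lemma act_zero (M : Matrix (Fin m) (Fin n) ℝ) : act M 0 = 0 := by
  ext i; simp [act_apply]

@[simp] lemma act_one (x : E n) : act (1 : Matrix (Fin n) (Fin n) ℝ) x = x := by
  simp [act]

@[simp] lemma zero_act (x : E n) : act (0 : Matrix (Fin m) (Fin n) ℝ) x = 0 := by
  simp [act]

lemma act_act (M : Matrix (Fin k) (Fin m) ℝ) (N : Matrix (Fin m) (Fin n) ℝ) (x : E n) :
    act M (act N x) = act (M * N) x := by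
  simp [act]

lemma add_act (M N : Matrix (Fin m) (Fin n) ℝ) (x : E n) :
    act (M + N) x = act M x + act N x := by
  ext i; simp [act_apply, add_mul, Finset.sum_add_distrib]

/-- The map `act M` as a continuous linear map. -/
noncomputable def actL (M : Matrix (Fin m) (Fin n) ℝ) : E n →L[ℝ] E m :=
  LinearMap.toContinuousLinearMap
    { toFun := act M
      map_add' := act_add M
      map_smul' := act_smul M }

@[fun_prop] lemma continuous_act (M : Matrix (Fin m) (Fin n) ℝ) : Continuous (act M) :=
  (actL M).continuous

lemma inner_act_right (M : Matrix (Fin m) (Fin n) ℝ) (y : E m) (x : E n) :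
    inner ℝ y (act M x) = inner ℝ (act Mᵀ y) x := by
  simp only [PiLp.inner_apply, act_apply, RCLike.inner_apply, conj_trivial, Finset.mul_sum,
    Finset.sum_mul, transpose_apply]
  rw [Finset.sum_comm]
  exact Finset.sum_congr rfl fun i _ => Finset.sum_congr rfl fun j _ => by ring

end Act

/-! ### Covariance matrices -/

section CovMat

variable {Ω : Type*} [MeasurableSpace Ω] {P : Measure Ω} {k m n : ℕ}

/-- The matrix of covariances of the coordinates of two random vectors. -/
noncomputable def covMat (P : Measure Ω) (X : Ω → E m) (Y : Ω → E n) :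
    Matrix (Fin m) (Fin n) ℝ :=
  Matrix.of fun i j => covariance (fun ω => X ω i) (fun ω => Y ω j) P

lemma covMat_apply (X : Ω → E m) (Y : Ω → E n) (i : Fin m) (j : Fin n) :
    covMat P X Y i j = covariance (fun ω => X ω i) (fun ω => Y ω j) P := rfl

lemma memLp_coord {X : Ω → E m} {p : ℝ≥0∞} (hX : MemLp X p P) (i : Fin m) :
    MemLp (fun ω => X ω i) p P :=
  (EuclideanSpace.proj (𝕜 := ℝ) i).comp_memLp' hX

lemma memLp_act {X : Ω → E n} {p : ℝ≥0∞} (M : Matrix (Fin m) (Fin n) ℝ) (hX : MemLp X p P) :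
    MemLp (fun ω => act M (X ω)) p P :=
  (actL M).comp_memLp' hX

lemma integral_act {X : Ω → E n} (M : Matrix (Fin m) (Fin n) ℝ) (hX : Integrable X P) :
    ∫ ω, act M (X ω) ∂P = act M (∫ ω, X ω ∂P) :=
  (actL M).integral_comp_comm hX

lemma covMat_transpose (X : Ω → E m) (Y : Ω → E n) : (covMat P X Y)ᵀ = covMat P Y X := by
  ext i j
  simp only [transpose_apply, covMat_apply]
  exact covariance_comm _ _

lemma covMat_map {Ω' : Type*} [MeasurableSpace Ω'] {Q : Measure Ω'} {Z : Ω' → Ω}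
    (hZ : Measurable Z) {X : Ω → E m} {Y : Ω → E n} (hX : Measurable X) (hY : Measurable Y) :
    covMat (Q.map Z) X Y = covMat Q (X ∘ Z) (Y ∘ Z) := by
  ext i j
  simp only [covMat_apply]
  rw [covariance_map_fun (by fun_prop) (by fun_prop) hZ.aemeasurable]
  rfl

lemma integrable_norm_sq {X : Ω → E m} (hX : MemLp X 2 P) :
    Integrable (fun ω => ‖X ω‖ ^ 2) P := hX.integrable_norm_pow two_ne_zero

lemma integral_coord {X : Ω → E m} (hX : Integrable X P) (i : Fin m) :
    ∫ ω, X ω i ∂P = (∫ ω, X ω ∂P) i :=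
  (EuclideanSpace.proj (𝕜 := ℝ) i).integral_comp_comm hX

variable [IsProbabilityMeasure P]

lemma covMat_act_left {X : Ω → E m} {Y : Ω → E n} (M : Matrix (Fin k) (Fin m) ℝ)
    (hX : MemLp X 2 P) (hY : MemLp Y 2 P) :
    covMat P (fun ω => act M (X ω)) Y = M * covMat P X Y := by
  ext i j
  simp only [covMat_apply, mul_apply, act_apply]
  rw [covariance_fun_sum_left (fun l => (memLp_coord hX l).const_mul _) (memLp_coord hY j)]
  simp only [covariance_const_mul_left]

lemma covMat_act_right {X : Ω → E m} {Y : Ω → E n} (M : Matrix (Fin k) (Fin n) ℝ)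
    (hX : MemLp X 2 P) (hY : MemLp Y 2 P) :
    covMat P X (fun ω => act M (Y ω)) = covMat P X Y * Mᵀ := by
  rw [← covMat_transpose, covMat_act_left M hY hX, transpose_mul, covMat_transpose]

lemma covMat_add_left {X Y : Ω → E m} {Z : Ω → E n}
    (hX : MemLp X 2 P) (hY : MemLp Y 2 P) (hZ : MemLp Z 2 P) :
    covMat P (fun ω => X ω + Y ω) Z = covMat P X Z + covMat P Y Z := by
  ext i j
  exact covariance_add_left (memLp_coord hX i) (memLp_coord hY i) (memLp_coord hZ j)

lemma covMat_add_right {X Y : Ω → E m} {Z : Ω → E n}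
    (hX : MemLp X 2 P) (hY : MemLp Y 2 P) (hZ : MemLp Z 2 P) :
    covMat P Z (fun ω => X ω + Y ω) = covMat P Z X + covMat P Z Y := by
  rw [← covMat_transpose, covMat_add_left hX hY hZ, transpose_add, covMat_transpose,
    covMat_transpose]

lemma covMat_sub_left {X Y : Ω → E m} {Z : Ω → E n}
    (hX : MemLp X 2 P) (hY : MemLp Y 2 P) (hZ : MemLp Z 2 P) :
    covMat P (fun ω => X ω - Y ω) Z = covMat P X Z - covMat P Y Z := by
  ext i j
  exact covariance_sub_left (memLp_coord hX i) (memLp_coord hY i) (memLp_coord hZ j)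

lemma covMat_sub_right {X Y : Ω → E m} {Z : Ω → E n}
    (hX : MemLp X 2 P) (hY : MemLp Y 2 P) (hZ : MemLp Z 2 P) :
    covMat P Z (fun ω => X ω - Y ω) = covMat P Z X - covMat P Z Y := by
  rw [← covMat_transpose, covMat_sub_left hX hY hZ, transpose_sub, covMat_transpose,
    covMat_transpose]

lemma covMat_sub_const_left {X : Ω → E m} {Y : Ω → E n} (a : E m) (hX : MemLp X 2 P) :
    covMat P (fun ω => X ω - a) Y = covMat P X Y := by
  ext i j
  exact covariance_sub_const_left ((memLp_coord hX i).integrable one_le_two) (a i)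

lemma covMat_sub_const_right {X : Ω → E m} {Y : Ω → E n} (a : E n) (hY : MemLp Y 2 P) :
    covMat P X (fun ω => Y ω - a) = covMat P X Y := by
  rw [← covMat_transpose, covMat_sub_const_left a hY, covMat_transpose]

lemma integral_norm_sq {X : Ω → E m} (hX : MemLp X 2 P) :
    ∫ ω, ‖X ω‖ ^ 2 ∂P = ‖∫ ω, X ω ∂P‖ ^ 2 + (covMat P X X).trace := by
  simp_rw [EuclideanSpace.real_norm_sq_eq]
  rw [integral_finsetSum _ fun i _ => (memLp_coord hX i).integrable_sq, trace,
    ← Finset.sum_add_distrib]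
  refine Finset.sum_congr rfl fun i _ => ?_
  rw [diag_apply, covMat_apply, covariance_eq_sub (memLp_coord hX i) (memLp_coord hX i),
    integral_coord (hX.integrable one_le_two)]
  simp only [Pi.mul_apply, sq]
  ring

lemma variance_dotProduct {X : Ω → E m} (hX : MemLp X 2 P) (v : Fin m → ℝ) :
    variance (fun ω => v ⬝ᵥ (X ω).ofLp) P = v ⬝ᵥ (covMat P X X *ᵥ v) := by
  simp only [dotProduct, mulVec, covMat_apply]
  have h : ∀ l, MemLp (fun ω => v l * X ω l) 2 P := fun l => (memLp_coord hX l).const_mul _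
  rw [← covariance_self (memLp_finsetSum _ fun l _ => h l).aemeasurable,
    covariance_fun_sum_fun_sum h h]
  simp only [covariance_const_mul_left, covariance_const_mul_right, Finset.mul_sum]
  exact Finset.sum_congr rfl fun i _ => Finset.sum_congr rfl fun j _ => by ring

lemma posSemidef_covMat {X : Ω → E m} (hX : MemLp X 2 P) : (covMat P X X).PosSemidef := by
  refine PosSemidef.of_dotProduct_mulVec_nonneg ?_ fun v => ?_
  · rw [IsHermitian, conjTranspose_eq_transpose_of_trivial, covMat_transpose]
  · rw [star_trivial, ← variance_dotProduct hX]
    exact variance_nonneg _ _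

/-- A random vector with singular covariance matrix lies in a hyperplane almost surely. -/
lemma exists_ae_dotProduct_eq_zero {X : Ω → E m} (hX : MemLp X 2 P)
    (h : ¬ (covMat P X X).PosDef) :
    ∃ v : Fin m → ℝ, v ≠ 0 ∧ ∀ᵐ ω ∂P, v ⬝ᵥ (X ω - ∫ ω', X ω' ∂P).ofLp = 0 := by
  have hex : ∃ v : Fin m → ℝ, v ≠ 0 ∧ v ⬝ᵥ (covMat P X X *ᵥ v) = 0 := by
    by_contra! hne
    refine h (PosDef.of_dotProduct_mulVec_pos (posSemidef_covMat hX).1 fun v hv => ?_)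
    exact lt_of_le_of_ne ((posSemidef_covMat hX).dotProduct_mulVec_nonneg v)
      (by simpa using (hne v hv).symm)
  obtain ⟨v, hv, h0⟩ := hex
  refine ⟨v, hv, ?_⟩
  have hL : MemLp (fun ω => v ⬝ᵥ (X ω).ofLp) 2 P := by
    simp only [dotProduct]
    exact memLp_finsetSum _ fun l _ => (memLp_coord hX l).const_mul _
  -- A real variance could vanish by a junk value, so the equation is moved to `evariance`, whose
  -- vanishing means almost sure constancy.
  rw [← variance_dotProduct hX, ← ENNReal.ofReal_eq_zero.trans
    ⟨fun h => le_antisymm h (variance_nonneg _ _), fun h => h.le⟩,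
    hL.ofReal_variance_eq, evariance_eq_zero_iff hL.aemeasurable] at h0
  filter_upwards [h0] with ω hω
  have hint : ∫ ω, v ⬝ᵥ (X ω).ofLp ∂P = v ⬝ᵥ (∫ ω, X ω ∂P).ofLp := by
    simp only [dotProduct]
    rw [integral_finsetSum _ fun l _ =>
      ((memLp_coord hX l).const_mul _).integrable one_le_two]
    simp only [integral_const_mul, integral_coord (hX.integrable one_le_two)]
  rw [WithLp.ofLp_sub, dotProduct_sub, hω, hint, sub_self]

/-- Each coordinate of NᵀX has variance zero, so it is almost surely constant and has zero
covariance with everything. This kernel inclusion is what makes regression on a degenerate X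
possible. -/
lemma covMat_mul_eq_zero {X : Ω → E m} {Y : Ω → E n} (hX : MemLp X 2 P) (hY : MemLp Y 2 P)
    {N : Matrix (Fin m) (Fin k) ℝ} (h : covMat P X X * N = 0) : covMat P Y X * N = 0 := by
  have hN := memLp_act Nᵀ hX
  have h0 : covMat P (fun ω => act Nᵀ (X ω)) (fun ω => act Nᵀ (X ω)) = 0 := by
    rw [covMat_act_left _ hX hN, covMat_act_right _ hX hX, transpose_transpose, h, Matrix.mul_zero]
  rw [← transpose_transpose N, ← covMat_act_right _ hY hX]
  ext i j
  have hj : covMat P (fun ω => act Nᵀ (X ω)) (fun ω => act Nᵀ (X ω)) j j = 0 := by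
    rw [h0]; rfl
  rw [covMat_apply, covariance_self (memLp_coord hN j).aemeasurable,
    ← ENNReal.ofReal_eq_zero.trans
      ⟨fun h => le_antisymm h (variance_nonneg _ _), fun h => h.le⟩,
    (memLp_coord hN j).ofReal_variance_eq,
    evariance_eq_zero_iff (memLp_coord hN j).aemeasurable] at hj
  rw [covMat_apply, covariance, Matrix.zero_apply]
  refine integral_eq_zero_of_ae ?_
  filter_upwards [hj] with ω hω
  simp [hω]

end CovMat

/-! ### Multivariate Gaussian measures -/

section Gaussian

variable {k m n : ℕ}

/-- The set is a translate of the kernel of a nonzero functional, a proper subspace, hence null for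
Haar measure. -/
lemma volume_hyperplane {v : Fin n → ℝ} (hv : v ≠ 0) (a : E n) :
    volume {x : E n | v ⬝ᵥ (x - a).ofLp = 0} = 0 := by
  have hf : ∀ x : E n, inner ℝ (WithLp.toLp 2 v) (x - a) = v ⬝ᵥ (x - a).ofLp := fun x => by
    simp [PiLp.inner_apply, dotProduct, mul_comm]
  have hker : (LinearMap.ker (innerSL ℝ (WithLp.toLp 2 v : E n)).toLinearMap) ≠ ⊤ := by
    intro h
    have h1 : (WithLp.toLp 2 v : E n) ∈
        LinearMap.ker (innerSL ℝ (WithLp.toLp 2 v : E n)).toLinearMap := by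
      rw [h]; trivial
    have h2 : inner ℝ (WithLp.toLp 2 v : E n) (WithLp.toLp 2 v) = 0 := h1
    exact hv (by simpa using inner_self_eq_zero.mp h2)
  have hset : {x : E n | v ⬝ᵥ (x - a).ofLp = 0} = (fun x => x + -a) ⁻¹'
      (LinearMap.ker (innerSL ℝ (WithLp.toLp 2 v : E n)).toLinearMap : Set (E n)) := by
    ext x
    rw [Set.mem_ofPred_eq, ← hf, sub_eq_add_neg]
    rfl
  rw [hset, measure_preimage_add_right]
  exact Measure.addHaar_submodule _ _ hker

lemma not_absolutelyContinuous_of_ae_dotProduct {μ : Measure (E n)} (hμ : μ ≠ 0)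
    {v : Fin n → ℝ} (hv : v ≠ 0) {a : E n} (h : ∀ᵐ x ∂μ, v ⬝ᵥ (x - a).ofLp = 0) :
    ¬ μ ≪ volume := by
  intro hac
  have h1 : ∀ᵐ x ∂μ, ¬ v ⬝ᵥ (x - a).ofLp = 0 := by
    refine hac.ae_le ?_
    change volume {x | ¬ ¬ v ⬝ᵥ (x - a).ofLp = 0} = 0
    simpa only [not_not] using volume_hyperplane hv a
  have h2 : ∀ᵐ x ∂μ, False := by
    filter_upwards [h, h1] with x hx hx' using hx' hx
  rw [Filter.eventually_false_iff_eq_bot, ae_eq_bot] at h2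
  exact hμ h2

lemma memLp_multivariateGaussian (m : E n) (S : Matrix (Fin n) (Fin n) ℝ) :
    MemLp (fun x : E n => x) 2 (multivariateGaussian m S) :=
  IsGaussian.memLp_two_id

lemma covMat_multivariateGaussian (m : E n) {S : Matrix (Fin n) (Fin n) ℝ}
    (hS : S.PosSemidef) :
    covMat (multivariateGaussian m S) (fun x => x) (fun x => x) = S := by
  ext i j
  exact covariance_eval_multivariateGaussian hS i j

lemma not_absolutelyContinuous_multivariateGaussian (m : E n) {S : Matrix (Fin n) (Fin n) ℝ}
    (hS : S.PosSemidef) (hS' : ¬ S.PosDef) : ¬ multivariateGaussian m S ≪ volume := by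
  obtain ⟨v, hv, h⟩ := exists_ae_dotProduct_eq_zero (memLp_multivariateGaussian m S)
    (by rwa [covMat_multivariateGaussian m hS])
  exact not_absolutelyContinuous_of_ae_dotProduct (IsProbabilityMeasure.ne_zero _) hv h

/-- It suffices to compare the two measures on boxes, where the integral of the product density
factors by Fubini. -/
lemma pi_withDensity_ofReal {f : ℝ → ℝ} (hf : Integrable f) (hf0 : ∀ x, 0 ≤ f x)
    [SigmaFinite (volume.withDensity fun x => ENNReal.ofReal (f x))] :
    (Measure.pi fun _ : Fin n => volume.withDensity fun x => ENNReal.ofReal (f x)) =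
      volume.withDensity fun x : Fin n → ℝ => ENNReal.ofReal (∏ i, f (x i)) := by
  refine Measure.pi_eq (μ := fun _ : Fin n => volume.withDensity fun x => ENNReal.ofReal (f x))
    fun s hs => ?_
  rw [withDensity_apply _ (MeasurableSet.univ_pi hs), volume_pi, Measure.restrict_pi_pi,
    ← ofReal_integral_eq_lintegral_ofReal (Integrable.fintype_prod fun i => hf.restrict)
      (ae_of_all _ fun x => Finset.prod_nonneg fun i _ => hf0 _),
    integral_fintype_prod_eq_prod,
    ENNReal.ofReal_prod_of_nonneg fun i _ => integral_nonneg fun x => hf0 x]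
  refine Finset.prod_congr rfl fun i _ => ?_
  rw [withDensity_apply _ (hs i),
    ofReal_integral_eq_lintegral_ofReal hf.restrict (ae_of_all _ hf0)]

lemma map_withDensity_comp {X Y : Type*} [MeasurableSpace X] [MeasurableSpace Y]
    (μ : Measure X) {e : X → Y} (he : Measurable e) {g : Y → ℝ≥0∞} (hg : Measurable g) :
    (μ.withDensity (g ∘ e)).map e = (μ.map e).withDensity g := by
  ext s hs
  rw [Measure.map_apply he hs, withDensity_apply _ (he hs), withDensity_apply _ hs,
    setLIntegral_map hs hg he]
  rfl

lemma stdGaussian_eq_withDensity (n : ℕ) : ∃ k : ℝ, stdGaussian (E n) =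
    volume.withDensity fun x => ENNReal.ofReal (Real.exp (k - ‖x‖ ^ 2 / 2)) := by
  -- The logarithm of the normalizing factor (2π)^(−n/2). Later arguments never use its value.
  refine ⟨n * Real.log (Real.sqrt (2 * Real.pi))⁻¹, ?_⟩
  have hg : (gaussianReal 0 1) =
      volume.withDensity fun x => ENNReal.ofReal (gaussianPDFReal 0 1 x) :=
    gaussianReal_of_var_ne_zero 0 one_ne_zero
  have : SigmaFinite (volume.withDensity fun x => ENNReal.ofReal (gaussianPDFReal 0 1 x)) := by
    rw [← hg]; infer_instance
  rw [← map_pi_eq_stdGaussian, hg,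
    pi_withDensity_ofReal (integrable_gaussianPDFReal 0 1) (gaussianPDFReal_nonneg 0 1),
    ← (PiLp.volume_preserving_toLp (Fin n)).map_eq,
    ← map_withDensity_comp _ (by fun_prop) (by fun_prop)]
  congr 2
  funext x
  rw [Function.comp_apply, sub_eq_add_neg, Real.exp_add, Real.exp_nat_mul,
    Real.exp_log (by positivity), EuclideanSpace.real_norm_sq_eq, Finset.sum_div,
    ← Finset.sum_neg_distrib, Real.exp_sum]
  simp [gaussianPDFReal_def, Finset.prod_mul_distrib, neg_div]

open scoped MatrixOrder in
/-- The density of a nondegenerate Gaussian measure is the exponential of a quadratic function. -/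
lemma exists_multivariateGaussian_eq_withDensity {S : Matrix (Fin n) (Fin n) ℝ}
    (hS : S.PosDef) : ∃ (M : Matrix (Fin n) (Fin n) ℝ) (k : ℝ), ∀ m : E n,
      multivariateGaussian m S = volume.withDensity fun x =>
        ENNReal.ofReal (Real.exp (k - ‖act M (x - m)‖ ^ 2 / 2)) := by
  obtain ⟨k, hk⟩ := stdGaussian_eq_withDensity n
  set R := CFC.sqrt S with hR
  have hRu : IsUnit R := by
    have h0 : 0 ≤ S := hS.posSemidef.nonneg
    rw [hR, CFC.isUnit_sqrt_iff S h0]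
    exact hS.isUnit
  have hdet : LinearMap.det (actL R).toLinearMap ≠ 0 := by
    have h1 : (actL R).toLinearMap = Matrix.toLpLin 2 2 R := by
      ext; rfl
    rw [h1, LinearMap.det_toLpLin]
    exact ((Matrix.isUnit_iff_isUnit_det _).mp hRu).ne_zero
  have hRR : R⁻¹ * R = 1 := Matrix.nonsing_inv_mul _ ((Matrix.isUnit_iff_isUnit_det _).mp hRu)
  set D := |(LinearMap.det (actL R).toLinearMap)⁻¹| with hD
  have hDpos : 0 < D := by positivity
  -- R⁻¹ is S^(−1/2), and D is the Jacobian factor |det R|⁻¹. Neither depends on m, so one pair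
  -- serves all the conditional laws of a policy, which differ only in their centre.
  refine ⟨R⁻¹, k + Real.log D, fun m => ?_⟩
  have hmap : (volume : Measure (E n)).map (fun x => m + act R x) =
      ENNReal.ofReal D • volume := by
    have h2 := Measure.map_linearMap_addHaar_eq_smul_addHaar (volume : Measure (E n)) hdet
    have h3 : (fun x => m + act R x) = (fun x => m + x) ∘ act R := rfl
    rw [h3, ← Measure.map_map (measurable_const_add m) (measurable_act R)]
    change (Measure.map (⇑(actL R).toLinearMap) volume).map _ = _
    rw [h2, Measure.map_smul, map_add_left_eq_self]
  have hstd : stdGaussian (E n) = volume.withDensity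
      ((fun x => ENNReal.ofReal (Real.exp (k - ‖act R⁻¹ (x - m)‖ ^ 2 / 2))) ∘
        fun x => m + act R x) := by
    rw [hk]
    congr 1
    funext x
    simp [act_act, hRR]
  have hG : multivariateGaussian m S = (stdGaussian (E n)).map (fun x => m + act R x) := rfl
  rw [hG, hstd, map_withDensity_comp _ (by fun_prop) (by fun_prop), hmap,
    withDensity_smul_measure, ← withDensity_smul _ (by fun_prop)]
  congr 1
  funext x
  rw [Pi.smul_apply, smul_eq_mul, ← ENNReal.ofReal_mul hDpos.le, add_sub_right_comm, Real.exp_add,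
    Real.exp_log hDpos, mul_comm]

instance (m : E n) (v : E k) (K : Matrix (Fin k) (Fin n) ℝ) (C : Matrix (Fin k) (Fin k) ℝ) :
    IsMarkovKernel (affineGaussianKernel m v K C) :=
  ⟨fun x => by
    change IsProbabilityMeasure (multivariateGaussian (v + act K (x - m)) C)
    infer_instance⟩

lemma affineGaussianKernel_apply (m : E n) (v : E k) (K : Matrix (Fin k) (Fin n) ℝ)
    (C : Matrix (Fin k) (Fin k) ℝ) (x : E n) :
    affineGaussianKernel m v K C x = multivariateGaussian (v + act K (x - m)) C := rfl

lemma dotProduct_mulVec_eq_inner (S : Matrix (Fin n) (Fin n) ℝ) (x : E n) :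
    x.ofLp ⬝ᵥ S *ᵥ x.ofLp = inner ℝ x (act S x) := by
  simp [PiLp.inner_apply, dotProduct, act, mul_comm]

/-- A linear image of an affine-Gaussian transition started from a Gaussian law is Gaussian. -/
lemma map_compProd_affineGaussianKernel {l : ℕ} (μ : E n) {S : Matrix (Fin n) (Fin n) ℝ}
    (hS : S.PosSemidef) (v : E k) (K : Matrix (Fin k) (Fin n) ℝ) {C : Matrix (Fin k) (Fin k) ℝ}
    (hC : C.PosSemidef) (A : Matrix (Fin l) (Fin n) ℝ) (B : Matrix (Fin l) (Fin k) ℝ) :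
    (multivariateGaussian μ S ⊗ₘ affineGaussianKernel μ v K C).map
        (fun z => act A z.1 + act B z.2) =
      multivariateGaussian (act A μ + act B v)
        (B * C * Bᵀ + (A + B * K) * S * (A + B * K)ᵀ) := by
  have hPSD : (B * C * Bᵀ + (A + B * K) * S * (A + B * K)ᵀ).PosSemidef := by
    have h1 := hC.mul_mul_conjTranspose_same B
    have h2 := hS.mul_mul_conjTranspose_same (A + B * K)
    rw [conjTranspose_eq_transpose_of_trivial] at h1 h2
    exact h1.add h2
  have : IsProbabilityMeasure ((multivariateGaussian μ S ⊗ₘ affineGaussianKernel μ v K C).map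
        (fun z => act A z.1 + act B z.2)) :=
    Measure.isProbabilityMeasure_map (by fun_prop)
  refine Measure.ext_of_charFun (funext fun t => ?_)
  -- Integrating out u leaves a constant times a character of x with frequency (A + BK)ᵀt, so the
  -- outer integral is again a Gaussian characteristic function.
  have hinner : ∀ x : E n, ∫ u, Complex.exp (inner ℝ (act A x + act B u) t * Complex.I)
      ∂(affineGaussianKernel μ v K C x) =
      Complex.exp (inner ℝ x (act (A + B * K)ᵀ t) * Complex.I) *
        Complex.exp ((inner ℝ (act Bᵀ t) v - inner ℝ (act (B * K)ᵀ t) μ : ℝ) * Complex.I -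
          ((act Bᵀ t).ofLp ⬝ᵥ C *ᵥ (act Bᵀ t).ofLp : ℝ) / 2) := fun x => by
    have h1 : ∀ u : E k, Complex.exp (inner ℝ (act A x + act B u) t * Complex.I) =
        Complex.exp (inner ℝ (act Aᵀ t) x * Complex.I) *
          Complex.exp (inner ℝ u (act Bᵀ t) * Complex.I) := fun u => by
      rw [← Complex.exp_add, inner_add_left, real_inner_comm, inner_act_right,
        real_inner_comm t (act B u), inner_act_right, real_inner_comm u]
      push_cast
      ring_nf
    simp_rw [h1]
    rw [integral_const_mul, ← charFun_apply, affineGaussianKernel_apply,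
      charFun_multivariateGaussian hC, ← Complex.exp_add, ← Complex.exp_add]
    congr 1
    have h2 : inner ℝ x (act (A + B * K)ᵀ t) =
        inner ℝ (act Aᵀ t) x + inner ℝ (act (B * K)ᵀ t) x := by
      rw [transpose_add, add_act, inner_add_right, real_inner_comm, real_inner_comm _ x]
    have h3 : inner ℝ (act Bᵀ t) (v + act K (x - μ)) = inner ℝ (act Bᵀ t) v +
        (inner ℝ (act (B * K)ᵀ t) x - inner ℝ (act (B * K)ᵀ t) μ) := by
      rw [inner_add_right, inner_act_right, inner_sub_right, act_act, transpose_mul]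
    rw [h2, h3]
    push_cast
    ring
  rw [charFun_multivariateGaussian hPSD, charFun_apply,
    integral_map (by fun_prop) (by fun_prop), Measure.integral_compProd]
  · simp_rw [hinner]
    rw [integral_mul_const, ← charFun_apply, charFun_multivariateGaussian hS, ← Complex.exp_add]
    congr 1
    have h4 : inner ℝ t (act A μ + act B v) = inner ℝ (act (A + B * K)ᵀ t) μ +
        (inner ℝ (act Bᵀ t) v - inner ℝ (act (B * K)ᵀ t) μ) := by
      rw [inner_add_right, inner_act_right, inner_act_right, transpose_add, add_act,
        inner_add_left]
      ring
    have h5 : t.ofLp ⬝ᵥ (B * C * Bᵀ + (A + B * K) * S * (A + B * K)ᵀ) *ᵥ t.ofLp =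
        (act Bᵀ t).ofLp ⬝ᵥ C *ᵥ (act Bᵀ t).ofLp +
        (act (A + B * K)ᵀ t).ofLp ⬝ᵥ S *ᵥ (act (A + B * K)ᵀ t).ofLp := by
      simp only [dotProduct_mulVec_eq_inner]
      rw [add_act, inner_add_right, ← act_act, ← act_act, ← act_act, ← act_act, inner_act_right,
        inner_act_right (A + B * K)]
    rw [h4]
    push_cast [h5]
    ring
  · refine Integrable.of_bound (C := 1) (by fun_prop) (ae_of_all _ fun z => ?_)
    rw [Complex.norm_exp_ofReal_mul_I]

end Gaussian

/-! ### Extended integrals -/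

section EIntegral

variable {X : Type*} [MeasurableSpace X] {μ : Measure X}

/-- The positive and negative parts move in opposite directions, and subtraction in `EReal` is
monotone even with ⊤ − ⊤ = ⊥. Hence entropies can be compared without integrability. -/
lemma eintegral_mono_ae {f g : X → EReal} (h : ∀ᵐ x ∂μ, f x ≤ g x) :
    eintegral μ f ≤ eintegral μ g := by
  refine EReal.sub_le_sub ?_ ?_ <;> rw [EReal.coe_ennreal_le_coe_ennreal_iff] <;>
    refine lintegral_mono_ae ?_ <;> filter_upwards [h] with x hx
  · exact EReal.toENNReal_le_toENNReal hx
  · exact EReal.toENNReal_le_toENNReal (EReal.neg_le_neg_iff.mpr hx)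

lemma eintegral_congr_ae {f g : X → EReal} (h : ∀ᵐ x ∂μ, f x = g x) :
    eintegral μ f = eintegral μ g :=
  le_antisymm (eintegral_mono_ae (h.mono fun _ hx => hx.le))
    (eintegral_mono_ae (h.mono fun _ hx => hx.ge))

lemma eintegral_coe {f : X → ℝ} (hf : Integrable f μ) :
    eintegral μ (fun x => (f x : EReal)) = ((∫ x, f x ∂μ : ℝ) : EReal) := by
  have h1 : ∫⁻ x, ENNReal.ofReal (f x) ∂μ ≠ ∞ := hf.lintegral_lt_top.ne
  have h2 : ∫⁻ x, ENNReal.ofReal (-f x) ∂μ ≠ ∞ := hf.neg.lintegral_lt_top.ne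
  simp only [eintegral, ← EReal.coe_neg, EReal.real_coe_toENNReal]
  rw [integral_eq_lintegral_pos_part_sub_lintegral_neg_part hf, EReal.coe_sub,
    EReal.coe_ennreal_toReal h1, EReal.coe_ennreal_toReal h2]

lemma eintegral_top (hμ : μ ≠ 0) : eintegral μ (fun _ => ⊤) = ⊤ := by
  simp [eintegral, ENNReal.top_mul, hμ]

end EIntegral

/-! ### Gibbs' inequality -/

/-- The tangent bound 1 + s ≤ exp s at s = q − log p, multiplied by p. At p = 0 the convention 0 ·
log 0 = 0 applies. -/
lemma gibbs_pointwise {p : ℝ} (hp : 0 ≤ p) (q : ℝ) :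
    p * q + p - Real.exp q ≤ p * Real.log p := by
  rcases hp.eq_or_lt with rfl | hp
  · simp [Real.exp_nonneg]
  · have h := Real.add_one_le_exp (q - Real.log p)
    rw [Real.exp_sub, Real.exp_log hp, le_div_iff₀ hp] at h
    linarith

section Gibbs

variable {X : Type*} [MeasurableSpace X] {μ ν l : Measure X} {q : X → ℝ}

lemma integrable_gibbs [IsFiniteMeasure μ] [SigmaFinite l] (hμ : μ ≪ l) (hq : Integrable q μ)
    (he : Integrable (fun x => Real.exp (q x)) l) :
    Integrable (fun x => (μ.rnDeriv l x).toReal * q x + (μ.rnDeriv l x).toReal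
      - Real.exp (q x)) l :=
  (((integrable_rnDeriv_smul_iff hμ).mpr hq).add Measure.integrable_toReal_rnDeriv).sub he

lemma integral_gibbs [IsFiniteMeasure μ] [SigmaFinite l] (hμ : μ ≪ l) (hq : Integrable q μ)
    (he : Integrable (fun x => Real.exp (q x)) l) :
    ∫ x, (μ.rnDeriv l x).toReal * q x + (μ.rnDeriv l x).toReal - Real.exp (q x) ∂l =
      ∫ x, q x ∂μ + μ.real Set.univ - ∫ x, Real.exp (q x) ∂l := by
  have h1 := (integrable_rnDeriv_smul_iff hμ).mpr hq
  simp only [smul_eq_mul] at h1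
  have h2 : Integrable (fun x => (μ.rnDeriv l x).toReal * q x + (μ.rnDeriv l x).toReal) l :=
    h1.add Measure.integrable_toReal_rnDeriv
  rw [integral_sub h2 he,
    integral_add h1 Measure.integrable_toReal_rnDeriv, Measure.integral_toReal_rnDeriv hμ]
  congr 2
  exact integral_rnDeriv_smul hμ

lemma lintegral_exp_eq (hν : ν = l.withDensity fun x => ENNReal.ofReal (Real.exp (q x))) :
    ∫⁻ x, ENNReal.ofReal (Real.exp (q x)) ∂l = ν Set.univ := by
  rw [hν, withDensity_apply _ MeasurableSet.univ, Measure.restrict_univ]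

lemma integrable_exp_of_withDensity [IsFiniteMeasure ν] (hm : Measurable q)
    (hν : ν = l.withDensity fun x => ENNReal.ofReal (Real.exp (q x))) :
    Integrable (fun x => Real.exp (q x)) l := by
  rw [← lintegral_ofReal_ne_top_iff_integrable (by fun_prop)
    (ae_of_all _ fun x => (Real.exp_pos _).le), lintegral_exp_eq hν]
  exact measure_ne_top _ _

lemma integral_exp_of_withDensity (hm : Measurable q)
    (hν : ν = l.withDensity fun x => ENNReal.ofReal (Real.exp (q x))) :
    ∫ x, Real.exp (q x) ∂l = ν.real Set.univ := by
  rw [integral_eq_lintegral_of_nonneg_ae (ae_of_all _ fun x => (Real.exp_pos _).le)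
    (by fun_prop), lintegral_exp_eq hν]
  rfl

/-- Among the finite measures of a given mass for which the log-density of `ν` has a given
integral, `ν` minimizes the Kullback-Leibler divergence. -/
lemma klDiv_le_klDiv [IsFiniteMeasure μ] [IsFiniteMeasure ν] [IsFiniteMeasure l]
    (hm : Measurable q) (hν : ν = l.withDensity fun x => ENNReal.ofReal (Real.exp (q x)))
    (hqμ : Integrable q μ) (hqν : Integrable q ν) (hint : ∫ x, q x ∂μ = ∫ x, q x ∂ν)
    (hmass : μ Set.univ = ν Set.univ) : klDiv ν l ≤ klDiv μ l := by
  by_cases h : μ ≪ l ∧ Integrable (llr μ l) μ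
  swap
  · rw [show klDiv μ l = ⊤ by rw [klDiv_eq_top_iff]; tauto]
    exact le_top
  have hνl : ν ≪ l := hν ▸ withDensity_absolutelyContinuous _ _
  -- This turns the divergence of ν into ∫ q dν = ∫ q dμ, up to mass terms shared with μ; Gibbs'
  -- inequality bounds ∫ q dμ by ∫ llr μ l dμ.
  have hllr : llr ν l =ᵐ[ν] q := by
    refine hνl.ae_le ?_
    have h1 : ν.rnDeriv l =ᵐ[l] fun x => ENNReal.ofReal (Real.exp (q x)) := by
      rw [hν]
      exact Measure.rnDeriv_withDensity _ (by fun_prop)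
    filter_upwards [h1] with x hx
    rw [llr, hx, ENNReal.toReal_ofReal (Real.exp_pos _).le, Real.log_exp]
  have hreal : μ.real Set.univ = ν.real Set.univ := by simp only [Measure.real, hmass]
  rw [klDiv_of_ac_of_integrable h.1 h.2,
    klDiv_of_ac_of_integrable hνl ((integrable_congr hllr).mpr hqν), integral_congr_ae hllr,
    ← hint, hreal]
  refine ENNReal.ofReal_le_ofReal ?_
  have he := integrable_exp_of_withDensity hm hν
  have h2 := integral_gibbs h.1 hqμ he
  have h3 : ∫ x, (μ.rnDeriv l x).toReal * llr μ l x ∂l = ∫ x, llr μ l x ∂μ :=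
    integral_rnDeriv_smul h.1
  have h4 : Integrable (fun x => (μ.rnDeriv l x).toReal * llr μ l x) l :=
    (integrable_rnDeriv_smul_iff h.1).mpr h.2
  have h5 := integral_mono (integrable_gibbs h.1 hqμ he) h4
    fun x => gibbs_pointwise ENNReal.toReal_nonneg (q x)
  rw [h2, h3, integral_exp_of_withDensity hm hν, hreal] at h5
  linarith

end Gibbs

section Entropy

variable {n : ℕ} {μ ν : Measure (E n)} {q : E n → ℝ}

/-- The differential entropy is at most the cross-entropy. -/
lemma entropy_le [IsProbabilityMeasure μ] [IsProbabilityMeasure ν] (hm : Measurable q)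
    (hν : ν = volume.withDensity fun x => ENNReal.ofReal (Real.exp (q x)))
    (hq : Integrable q μ) : entropy μ ≤ ((-∫ x, q x ∂μ : ℝ) : EReal) := by
  rw [entropy]
  split_ifs with h
  · rw [EReal.coe_neg, EReal.neg_le_neg_iff]
    have he := integrable_exp_of_withDensity hm hν
    have h1 := integral_gibbs h hq he
    rw [integral_exp_of_withDensity hm hν, probReal_univ, probReal_univ, add_sub_cancel_right]
      at h1
    -- The lower bound is rewritten as an extended integral because p log p itself need not be
    -- integrable.
    rw [← h1, ← eintegral_coe (integrable_gibbs h hq he)]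
    refine eintegral_mono_ae (ae_of_all _ fun x => ?_)
    exact EReal.coe_le_coe_iff.mpr (gibbs_pointwise ENNReal.toReal_nonneg _)
  · exact bot_le

/-- The equality case of `entropy_le`: p = exp q gives p log p = p q. -/
lemma entropy_withDensity [IsProbabilityMeasure ν] (hm : Measurable q)
    (hν : ν = volume.withDensity fun x => ENNReal.ofReal (Real.exp (q x)))
    (hq : Integrable q ν) : entropy ν = ((-∫ x, q x ∂ν : ℝ) : EReal) := by
  have hac : ν ≪ volume := hν ▸ withDensity_absolutelyContinuous _ _
  have h1 : ν.rnDeriv volume =ᵐ[volume] fun x => ENNReal.ofReal (Real.exp (q x)) := by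
    rw [hν]
    exact Measure.rnDeriv_withDensity _ (by fun_prop)
  rw [entropy, if_pos hac, EReal.coe_neg, ← integral_rnDeriv_smul hac,
    ← eintegral_coe ((integrable_rnDeriv_smul_iff hac).mpr hq)]
  congr 1
  refine eintegral_congr_ae ?_
  filter_upwards [h1] with x hx
  rw [hx, ENNReal.toReal_ofReal (Real.exp_pos _).le, Real.log_exp, smul_eq_mul]

end Entropy

/-! ### Gaussian comparison -/

section Comparison

variable {n : ℕ}

lemma smul_multivariateGaussian_eq_withDensity {c : ℝ} (hc : 0 < c)
    {S : Matrix (Fin n) (Fin n) ℝ} (hS : S.PosDef) :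
    ∃ (M : Matrix (Fin n) (Fin n) ℝ) (k : ℝ), ∀ m : E n,
      ENNReal.ofReal c • multivariateGaussian m S = volume.withDensity fun x =>
        ENNReal.ofReal (Real.exp (k - ‖act M (x - m)‖ ^ 2 / 2)) := by
  obtain ⟨M, k, h⟩ := exists_multivariateGaussian_eq_withDensity hS
  refine ⟨M, k + Real.log c, fun m => ?_⟩
  rw [h, ← withDensity_smul _ (by fun_prop)]
  congr 1
  funext x
  rw [Pi.smul_apply, smul_eq_mul, ← ENNReal.ofReal_mul hc.le, add_sub_right_comm, Real.exp_add,
    Real.exp_log hc, mul_comm]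

lemma integrable_norm_sq_act {P : Measure (E n)} [IsProbabilityMeasure P]
    (hP : MemLp (fun x : E n => x) 2 P) (M : Matrix (Fin n) (Fin n) ℝ) (a : E n) :
    Integrable (fun x => ‖act M (x - a)‖ ^ 2) P :=
  integrable_norm_sq (memLp_act M (hP.sub (memLp_const a)))

/-- The right side sees P only through its mean and covariance, so P and its Gaussian counterpart
give the same value to any Gaussian log-density. -/
lemma integral_norm_sq_act {P : Measure (E n)} [IsProbabilityMeasure P]
    (hP : MemLp (fun x : E n => x) 2 P) (M : Matrix (Fin n) (Fin n) ℝ) (a : E n) :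
    ∫ x, ‖act M (x - a)‖ ^ 2 ∂P = ‖act M ((∫ x, x ∂P) - a)‖ ^ 2 +
      (M * covMat P (fun x => x) (fun x => x) * Mᵀ).trace := by
  have h1 : MemLp (fun x => x - a) 2 P := hP.sub (memLp_const a)
  rw [integral_norm_sq (memLp_act M h1), integral_act M (h1.integrable one_le_two),
    integral_sub (hP.integrable one_le_two) (integrable_const a), integral_const,
    covMat_act_left _ h1 (memLp_act M h1), covMat_act_right _ h1 h1, covMat_sub_const_left a hP,
    covMat_sub_const_right a hP]
  simp [Matrix.mul_assoc]

/-- Replacing a measure by the Gaussian measure with the same mass, mean and covariance does not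
increase its Kullback-Leibler divergence from a nondegenerate Gaussian measure. -/
lemma klDiv_gaussian_le {P : Measure (E n)} [IsProbabilityMeasure P]
    (hP : MemLp (fun x : E n => x) 2 P) {c : ℝ} (hc : 0 < c) {a : ℝ} (ha : 0 < a) (m : E n)
    {S : Matrix (Fin n) (Fin n) ℝ} (hS : S.PosDef) :
    klDiv (ENNReal.ofReal c • multivariateGaussian (∫ x, x ∂P)
        (covMat P (fun x => x) (fun x => x))) (ENNReal.ofReal a • multivariateGaussian m S) ≤
      klDiv (ENNReal.ofReal c • P) (ENNReal.ofReal a • multivariateGaussian m S) := by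
  set C := covMat P (fun x => x) (fun x => x) with hC
  set μ := ∫ x, x ∂P with hμ
  have hCp : C.PosSemidef := posSemidef_covMat hP
  obtain ⟨M₁, k₁, h₁⟩ := smul_multivariateGaussian_eq_withDensity ha hS
  have : IsFiniteMeasure (ENNReal.ofReal c • P) := Measure.smul_finite _ ENNReal.ofReal_ne_top
  have : IsFiniteMeasure (ENNReal.ofReal c • multivariateGaussian μ C) :=
    Measure.smul_finite _ ENNReal.ofReal_ne_top
  have : IsFiniteMeasure (ENNReal.ofReal a • multivariateGaussian m S) :=
    Measure.smul_finite _ ENNReal.ofReal_ne_top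
  have hc0 : ENNReal.ofReal c ≠ 0 := by simpa using hc
  by_cases hCd : C.PosDef
  swap
  -- A degenerate P lives on a hyperplane, so the divergence on the right is infinite.
  · obtain ⟨v, hv, hae⟩ := exists_ae_dotProduct_eq_zero hP hCd
    have hnot : ¬ ENNReal.ofReal c • P ≪ ENNReal.ofReal a • multivariateGaussian m S := by
      intro hac
      refine not_absolutelyContinuous_of_ae_dotProduct (IsProbabilityMeasure.ne_zero P) hv hae ?_
      have h2 : P ≪ ENNReal.ofReal c • P := Measure.absolutelyContinuous_smul hc0
      refine (h2.trans hac).trans ?_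
      rw [h₁]
      exact withDensity_absolutelyContinuous _ _
    rw [klDiv_of_not_ac hnot]
    exact le_top
  obtain ⟨M₂, k₂, h₂⟩ := smul_multivariateGaussian_eq_withDensity hc hCd
  have hint : ∀ (Q : Measure (E n)) [IsProbabilityMeasure Q], MemLp (fun x : E n => x) 2 Q →
      Integrable (fun x => (k₂ - ‖act M₂ (x - μ)‖ ^ 2 / 2) - (k₁ - ‖act M₁ (x - m)‖ ^ 2 / 2)) Q :=
    fun Q _ hQ => ((integrable_const k₂).sub ((integrable_norm_sq_act hQ M₂ μ).div_const 2)).sub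
      ((integrable_const k₁).sub ((integrable_norm_sq_act hQ M₁ m).div_const 2))
  have hval : ∀ (Q : Measure (E n)) [IsProbabilityMeasure Q], MemLp (fun x : E n => x) 2 Q →
      ∫ x, (k₂ - ‖act M₂ (x - μ)‖ ^ 2 / 2) - (k₁ - ‖act M₁ (x - m)‖ ^ 2 / 2) ∂Q =
        (k₂ - (∫ x, ‖act M₂ (x - μ)‖ ^ 2 ∂Q) / 2) -
          (k₁ - (∫ x, ‖act M₁ (x - m)‖ ^ 2 ∂Q) / 2) := fun Q _ hQ => by
    have i1 := (integrable_norm_sq_act hQ M₂ μ).div_const 2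
    have i2 := (integrable_norm_sq_act hQ M₁ m).div_const 2
    have i3 : Integrable (fun x => k₂ - ‖act M₂ (x - μ)‖ ^ 2 / 2) Q := (integrable_const k₂).sub i1
    have i4 : Integrable (fun x => k₁ - ‖act M₁ (x - m)‖ ^ 2 / 2) Q := (integrable_const k₁).sub i2
    rw [integral_sub i3 i4,
      integral_sub (integrable_const k₂) i1, integral_sub (integrable_const k₁) i2]
    simp [integral_div]
  have hG := memLp_multivariateGaussian μ C
  -- q is the difference of the two Lebesgue log-densities, that is, the log-density of the Gaussian
  -- relative to the reference.
  refine klDiv_le_klDiv (q := fun x =>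
      (k₂ - ‖act M₂ (x - μ)‖ ^ 2 / 2) - (k₁ - ‖act M₁ (x - m)‖ ^ 2 / 2)) (by fun_prop) ?_
    ((hint P hP).smul_measure ENNReal.ofReal_ne_top)
    ((hint _ hG).smul_measure ENNReal.ofReal_ne_top) ?_ (by simp)
  · rw [h₁, h₂, ← withDensity_mul _ (by fun_prop) (by fun_prop)]
    congr 1
    funext x
    rw [Pi.mul_apply, ← ENNReal.ofReal_mul (Real.exp_pos _).le, ← Real.exp_add]
    congr 2
    ring
  · rw [integral_smul_measure, integral_smul_measure, hval P hP, hval _ hG,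
      integral_norm_sq_act hP, integral_norm_sq_act hP, integral_norm_sq_act hG,
      integral_norm_sq_act hG, covMat_multivariateGaussian μ hCp,
      integral_id_multivariateGaussian]

end Comparison

/-! ### Linear regression -/

section Regression

variable {Ω : Type*} [MeasurableSpace Ω] {P : Measure Ω} {k m n : ℕ}
  {X : Ω → E n} {Y : Ω → E k}

/-- The matrix of the best affine predictor of `Y` from `X`. -/
noncomputable def regMat (P : Measure Ω) (X : Ω → E n) (Y : Ω → E k) : Matrix (Fin k) (Fin n) ℝ :=
  covMat P Y X * pinv (covMat P X X)

/-- The covariance matrix of the residual of the best affine predictor of `Y` from `X`. -/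
noncomputable def residualCov (P : Measure Ω) (X : Ω → E n) (Y : Ω → E k) :
    Matrix (Fin k) (Fin k) ℝ :=
  covMat P Y Y - covMat P Y X * pinv (covMat P X X) * (covMat P Y X)ᵀ

/-- The residual of the best affine predictor of `Y` from `X`. -/
noncomputable def residual (P : Measure Ω) (X : Ω → E n) (Y : Ω → E k) (ω : Ω) : E k :=
  Y ω - ((∫ ω', Y ω' ∂P) + act (regMat P X Y) (X ω - ∫ ω', X ω' ∂P))

lemma residualCov_eq : residualCov P X Y = covMat P Y Y - regMat P X Y * covMat P X Y := by
  rw [residualCov, covMat_transpose, regMat]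

lemma residual_eq : residual P X Y = fun ω => (Y ω - act (regMat P X Y) (X ω)) -
    ((∫ ω', Y ω' ∂P) - act (regMat P X Y) (∫ ω', X ω' ∂P)) := by
  funext ω
  rw [residual, act_sub]
  abel

variable [IsProbabilityMeasure P]

/-- The normal equations. Since Σ(1 − Σ†Σ) = 0 by the first Penrose equation, `covMat_mul_eq_zero`
gives Λ(1 − Σ†Σ) = 0. The other Penrose equations play no role. -/
lemma regMat_mul_covMat (hX : MemLp X 2 P) (hY : MemLp Y 2 P) :
    regMat P X Y * covMat P X X = covMat P Y X := by
  have h := isMoorePenrose_pinv (covMat P X X)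
  have h0 : covMat P X X * (1 - pinv (covMat P X X) * covMat P X X) = 0 := by
    rw [Matrix.mul_sub, Matrix.mul_one, ← Matrix.mul_assoc, h.mul_mul_left, sub_self]
  have h1 := covMat_mul_eq_zero hX hY h0
  rw [Matrix.mul_sub, Matrix.mul_one, sub_eq_zero, ← Matrix.mul_assoc] at h1
  exact h1.symm

lemma covMat_mul_transpose_regMat (hX : MemLp X 2 P) (hY : MemLp Y 2 P) :
    covMat P X X * (regMat P X Y)ᵀ = covMat P X Y := by
  rw [← covMat_transpose X X, ← transpose_mul, regMat_mul_covMat hX hY, covMat_transpose]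

lemma memLp_residual (hX : MemLp X 2 P) (hY : MemLp Y 2 P) : MemLp (residual P X Y) 2 P := by
  have h1 : MemLp (fun ω => X ω - ∫ ω', X ω' ∂P) 2 P := hX.sub (memLp_const _)
  have h2 := (memLp_const (∫ ω, Y ω ∂P)).add (memLp_act (regMat P X Y) h1)
  exact hY.sub h2

lemma integral_residual (hX : MemLp X 2 P) (hY : MemLp Y 2 P) :
    ∫ ω, residual P X Y ω ∂P = 0 := by
  have hX1 := hX.integrable one_le_two
  have hY1 := hY.integrable one_le_two
  have hK : Integrable (fun ω => act (regMat P X Y) (X ω)) P :=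
    (memLp_act _ hX).integrable one_le_two
  have h1 : Integrable (fun ω => Y ω - act (regMat P X Y) (X ω)) P := hY1.sub hK
  rw [residual_eq, integral_sub h1 (integrable_const _), integral_sub hY1 hK,
    integral_act _ hX1]
  simp

/-- By the normal equations the residual is uncorrelated with X, so the cross terms cancel. Positive
semidefiniteness of the policy covariance follows. -/
lemma covMat_residual (hX : MemLp X 2 P) (hY : MemLp Y 2 P) :
    covMat P (residual P X Y) (residual P X Y) = residualCov P X Y := by
  have hK := memLp_act (regMat P X Y) hX
  have h1 : MemLp (fun ω => Y ω - act (regMat P X Y) (X ω)) 2 P := hY.sub hK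
  rw [residual_eq, covMat_sub_const_left _ h1, covMat_sub_const_right _ h1,
    covMat_sub_left hY hK h1, covMat_sub_right hY hK hY, covMat_sub_right hY hK hK,
    covMat_act_right _ hY hX, covMat_act_left _ hX hY, covMat_act_left _ hX hK,
    covMat_act_right _ hX hX, covMat_mul_transpose_regMat hX hY, sub_self, sub_zero,
    residualCov_eq, ← regMat_mul_covMat hX hY, Matrix.mul_assoc,
    covMat_mul_transpose_regMat hX hY]

lemma posSemidef_residualCov (hX : MemLp X 2 P) (hY : MemLp Y 2 P) :
    (residualCov P X Y).PosSemidef := by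
  rw [← covMat_residual hX hY]
  exact posSemidef_covMat (memLp_residual hX hY)

/-- Up to a constant, AX + BY = (A + BK)X + BW with W the residual, uncorrelated with X. The proof
checks the identity by bilinear expansion and the normal equations. -/
lemma covMat_linear_combination (hX : MemLp X 2 P) (hY : MemLp Y 2 P)
    (A : Matrix (Fin m) (Fin n) ℝ) (B : Matrix (Fin m) (Fin k) ℝ) :
    covMat P (fun ω => act A (X ω) + act B (Y ω)) (fun ω => act A (X ω) + act B (Y ω)) =
      B * residualCov P X Y * Bᵀ +
        (A + B * regMat P X Y) * covMat P X X * (A + B * regMat P X Y)ᵀ := by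
  have hA := memLp_act A hX
  have hB := memLp_act B hY
  have hAB : MemLp (fun ω => act A (X ω) + act B (Y ω)) 2 P := hA.add hB
  have h1 : (A + B * regMat P X Y) * covMat P X X = A * covMat P X X + B * covMat P Y X := by
    rw [Matrix.add_mul, Matrix.mul_assoc B, regMat_mul_covMat hX hY]
  rw [covMat_add_left hA hB hAB, covMat_add_right hA hB hA, covMat_add_right hA hB hB,
    covMat_act_left _ hX hA, covMat_act_left _ hX hB, covMat_act_left _ hY hA,
    covMat_act_left _ hY hB, covMat_act_right _ hX hX, covMat_act_right _ hX hY,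
    covMat_act_right _ hY hX, covMat_act_right _ hY hY, h1, transpose_add, transpose_mul,
    residualCov_eq]
  have h2 : B * covMat P Y X * ((regMat P X Y)ᵀ * Bᵀ) =
      B * (regMat P X Y * covMat P X Y) * Bᵀ := by
    rw [← regMat_mul_covMat hX hY, ← covMat_mul_transpose_regMat hX hY]
    simp only [Matrix.mul_assoc]
  have h3 : A * covMat P X X * ((regMat P X Y)ᵀ * Bᵀ) = A * (covMat P X Y * Bᵀ) := by
    rw [← covMat_mul_transpose_regMat hX hY]
    simp only [Matrix.mul_assoc]
  rw [Matrix.mul_add, Matrix.add_mul, Matrix.add_mul _ _ ((regMat P X Y)ᵀ * Bᵀ), h2, h3,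
    Matrix.mul_sub, Matrix.sub_mul]
  simp only [Matrix.mul_assoc]
  abel

/-- The Gaussian law of `X` followed by the affine-Gaussian regression of `Y` on `X` reproduces the
first two moments of every linear combination of `X` and `Y`. -/
lemma map_regression (hX : MemLp X 2 P) (hY : MemLp Y 2 P)
    (A : Matrix (Fin m) (Fin n) ℝ) (B : Matrix (Fin m) (Fin k) ℝ) :
    (multivariateGaussian (∫ ω, X ω ∂P) (covMat P X X) ⊗ₘ affineGaussianKernel (∫ ω, X ω ∂P)
        (∫ ω, Y ω ∂P) (regMat P X Y) (residualCov P X Y)).map (fun z => act A z.1 + act B z.2) =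
      multivariateGaussian (∫ ω, act A (X ω) + act B (Y ω) ∂P)
        (covMat P (fun ω => act A (X ω) + act B (Y ω)) (fun ω => act A (X ω) + act B (Y ω))) := by
  rw [map_compProd_affineGaussianKernel _ (posSemidef_covMat hX) _ _
    (posSemidef_residualCov hX hY), covMat_linear_combination hX hY,
    integral_add ((memLp_act A hX).integrable one_le_two)
      ((memLp_act B hY).integrable one_le_two),
    integral_act _ (hX.integrable one_le_two), integral_act _ (hY.integrable one_le_two)]

end Regression

/-! ### Second moments as Lebesgue integrals -/

section SecondMoment

variable {Ω : Type*} [MeasurableSpace Ω] {P : Measure Ω} {n : ℕ} {X : Ω → E n}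

lemma memLp_two_iff (hX : AEStronglyMeasurable X P) :
    MemLp X 2 P ↔ ∫⁻ ω, ‖X ω‖ₑ ^ 2 ∂P < ∞ := by
  rw [MemLp, and_iff_right hX, eLpNorm_lt_top_iff_lintegral_rpow_enorm_lt_top two_ne_zero
    ENNReal.ofNat_ne_top]
  simp

lemma lintegral_enorm_sq [IsProbabilityMeasure P] (hX : MemLp X 2 P) :
    ∫⁻ ω, ‖X ω‖ₑ ^ 2 ∂P =
      ENNReal.ofReal (‖∫ ω, X ω ∂P‖ ^ 2 + (covMat P X X).trace) := by
  rw [← integral_norm_sq hX, ofReal_integral_eq_lintegral_ofReal (integrable_norm_sq hX)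
    (ae_of_all _ fun ω => by positivity)]
  refine lintegral_congr fun ω => ?_
  rw [ENNReal.ofReal_pow (norm_nonneg _), ofReal_norm]

end SecondMoment

/-! ### State and joint laws -/

section Laws

variable {d d' T t : ℕ} {A : Matrix (Fin d) (Fin d) ℝ} {B : Matrix (Fin d) (Fin d') ℝ}
  {π₁ : Measure (E d)} {U : ℕ → Kernel (E d) (E d')}

lemma stateMeasure_succ (ht : 1 ≤ t) : stateMeasure A B π₁ U (t + 1) =
    (stateMeasure A B π₁ U t ⊗ₘ U t).map (fun z => act A z.1 + act B z.2) := by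
  obtain ⟨s, rfl⟩ := Nat.exists_eq_add_of_le' ht
  rfl

lemma isFiniteMeasure_init (hT : 1 ≤ T) (hU : Admissible T A B π₁ U) : IsFiniteMeasure π₁ :=
  hU.finite 1 (Finset.mem_Icc.mpr ⟨le_rfl, hT⟩)

lemma stateMeasure_univ (hU : Admissible T A B π₁ U) (h1 : 1 ≤ t) (hT : t ≤ T) :
    stateMeasure A B π₁ U t Set.univ = π₁ Set.univ := by
  induction t, h1 using Nat.le_induction with
  | base => rfl
  | succ t ht ih =>
    have := hU.markov t (Finset.mem_Ico.mpr ⟨ht, hT⟩)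
    have := hU.finite t (Finset.mem_Icc.mpr ⟨ht, by omega⟩)
    rw [stateMeasure_succ ht, Measure.map_apply (by fun_prop) MeasurableSet.univ,
      Set.preimage_univ, Measure.compProd_apply_univ, ih (by omega)]

lemma smul_stateLaw (hT1 : 1 ≤ T) (hU : Admissible T A B π₁ U) (hπ : π₁ ≠ 0) :
    stateMeasure A B π₁ U t = π₁ Set.univ • stateLaw A B π₁ U t := by
  have := isFiniteMeasure_init hT1 hU
  rw [stateLaw, smul_smul, ENNReal.mul_inv_cancel (by simpa using hπ) (measure_ne_top _ _),
    one_smul]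

lemma isProbabilityMeasure_stateLaw (hU : Admissible T A B π₁ U) (hπ : π₁ ≠ 0) (h1 : 1 ≤ t)
    (hT : t ≤ T) : IsProbabilityMeasure (stateLaw A B π₁ U t) := by
  have := isFiniteMeasure_init (h1.trans hT) hU
  refine ⟨?_⟩
  rw [stateLaw, Measure.smul_apply, stateMeasure_univ hU h1 hT, smul_eq_mul,
    ENNReal.inv_mul_cancel (by simpa using hπ) (measure_ne_top _ _)]

lemma memLp_stateLaw (hU : Admissible T A B π₁ U) (hπ : π₁ ≠ 0) (h1 : 1 ≤ t) (hT : t ≤ T) :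
    MemLp (fun x => x) 2 (stateLaw A B π₁ U t) := by
  have h : MemLp (fun x => x) 2 (stateMeasure A B π₁ U t) :=
    (memLp_two_iff (by fun_prop)).mpr (hU.secondMoment t (Finset.mem_Icc.mpr ⟨h1, hT⟩))
  exact h.smul_measure (by simpa using hπ)

lemma jointLaw_eq_compProd (hU : Admissible T A B π₁ U) (h1 : 1 ≤ t) (hT : t < T) :
    jointLaw A B π₁ U t = stateLaw A B π₁ U t ⊗ₘ U t := by
  have := hU.markov t (Finset.mem_Ico.mpr ⟨h1, hT⟩)
  have := hU.finite t (Finset.mem_Icc.mpr ⟨h1, hT.le⟩)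
  rw [jointLaw, stateLaw, Measure.compProd_smul_left]

lemma isProbabilityMeasure_jointLaw
    (hU : Admissible T A B π₁ U) (hπ : π₁ ≠ 0) (h1 : 1 ≤ t) (hT : t < T) :
    IsProbabilityMeasure (jointLaw A B π₁ U t) := by
  have := hU.markov t (Finset.mem_Ico.mpr ⟨h1, hT⟩)
  have := isProbabilityMeasure_stateLaw hU hπ h1 hT.le
  rw [jointLaw_eq_compProd hU h1 hT]
  infer_instance

lemma map_fst_jointLaw
    (hU : Admissible T A B π₁ U) (hπ : π₁ ≠ 0) (h1 : 1 ≤ t) (hT : t < T) :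
    (jointLaw A B π₁ U t).map Prod.fst = stateLaw A B π₁ U t := by
  have := hU.markov t (Finset.mem_Ico.mpr ⟨h1, hT⟩)
  have := isProbabilityMeasure_stateLaw hU hπ h1 hT.le
  rw [jointLaw_eq_compProd hU h1 hT]
  exact Measure.fst_compProd _ _

lemma stateLaw_succ (h1 : 1 ≤ t) : stateLaw A B π₁ U (t + 1) =
    (jointLaw A B π₁ U t).map (fun z => act A z.1 + act B z.2) := by
  rw [stateLaw, jointLaw, stateMeasure_succ h1, Measure.map_smul]

lemma memLp_fst_jointLaw
    (hU : Admissible T A B π₁ U) (hπ : π₁ ≠ 0) (h1 : 1 ≤ t) (hT : t < T) :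
    MemLp Prod.fst 2 (jointLaw A B π₁ U t) := by
  have h := memLp_stateLaw hU hπ h1 hT.le
  rw [← map_fst_jointLaw hU hπ h1 hT, memLp_map_measure_iff (by fun_prop) (by fun_prop)] at h
  exact h

lemma lintegral_control
    (hU : Admissible T A B π₁ U) (hπ : π₁ ≠ 0) (h1 : 1 ≤ t) (hT : t < T) :
    ∫⁻ x, ∫⁻ u, ‖u‖ₑ ^ 2 ∂(U t x) ∂(stateMeasure A B π₁ U t) =
    π₁ Set.univ * ∫⁻ z, ‖z.2‖ₑ ^ 2 ∂(jointLaw A B π₁ U t) := by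
  have := hU.markov t (Finset.mem_Ico.mpr ⟨h1, hT⟩)
  have := isProbabilityMeasure_stateLaw hU hπ h1 hT.le
  rw [jointLaw_eq_compProd hU h1 hT, Measure.lintegral_compProd (by fun_prop),
    smul_stateLaw (h1.trans hT.le) hU hπ, lintegral_smul_measure, smul_eq_mul]

lemma memLp_snd_jointLaw
    (hU : Admissible T A B π₁ U) (hπ : π₁ ≠ 0) (h1 : 1 ≤ t) (hT : t < T) :
    MemLp Prod.snd 2 (jointLaw A B π₁ U t) := by
  rw [memLp_two_iff (by fun_prop)]
  have h := (ENNReal.sum_lt_top.mp hU.energy) t (Finset.mem_Ico.mpr ⟨h1, hT⟩)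
  rw [lintegral_control hU hπ h1 hT] at h
  exact ENNReal.lt_top_of_mul_ne_top_right h.ne (by simpa using hπ)

lemma stateMean_eq
    (hU : Admissible T A B π₁ U) (hπ : π₁ ≠ 0) (h1 : 1 ≤ t) (hT : t < T) :
    stateMean A B π₁ U t = ∫ z, z.1 ∂(jointLaw A B π₁ U t) := by
  rw [stateMean, ← map_fst_jointLaw hU hπ h1 hT, integral_map (by fun_prop) (by fun_prop)]

lemma stateCov_eq
    (hU : Admissible T A B π₁ U) (hπ : π₁ ≠ 0) (h1 : 1 ≤ t) (hT : t < T) :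
    stateCov A B π₁ U t = covMat (jointLaw A B π₁ U t) Prod.fst Prod.fst := by
  change covMat (stateLaw A B π₁ U t) (fun x => x) (fun x => x) = _
  rw [← map_fst_jointLaw hU hπ h1 hT, covMat_map (by fun_prop) (by fun_prop) (by fun_prop)]
  rfl

/-- Puts all moments under one law, the joint law of state and control, where the regression lemmas
apply. -/
lemma gaussianPolicy_eq
    (hU : Admissible T A B π₁ U) (hπ : π₁ ≠ 0) (h1 : 1 ≤ t) (hT : t < T) :
    gaussianPolicy A B π₁ U t =
    affineGaussianKernel (∫ z, z.1 ∂(jointLaw A B π₁ U t)) (∫ z, z.2 ∂(jointLaw A B π₁ U t))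
      (regMat (jointLaw A B π₁ U t) Prod.fst Prod.snd)
      (residualCov (jointLaw A B π₁ U t) Prod.fst Prod.snd) := by
  rw [gaussianPolicy, stateMean_eq hU hπ h1 hT, stateCov_eq hU hπ h1 hT]
  rfl

end Laws

/-! ### The Gaussian pair -/

section GaussianPair

variable {d d' T t : ℕ} {A : Matrix (Fin d) (Fin d) ℝ} {B : Matrix (Fin d) (Fin d') ℝ}
  {π₁ : Measure (E d)} {U : ℕ → Kernel (E d) (E d')}

instance : IsMarkovKernel (gaussianPolicy A B π₁ U t) := by
  rw [gaussianPolicy]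
  infer_instance

lemma stateMean_succ (h1 : 1 ≤ t) :
    stateMean A B π₁ U (t + 1) =
      ∫ z, act A z.1 + act B z.2 ∂(jointLaw A B π₁ U t) := by
  rw [stateMean, stateLaw_succ h1, integral_map (by fun_prop) (by fun_prop)]

lemma stateCov_succ (h1 : 1 ≤ t) :
    stateCov A B π₁ U (t + 1) = covMat (jointLaw A B π₁ U t)
      (fun z => act A z.1 + act B z.2) (fun z => act A z.1 + act B z.2) := by
  change covMat (stateLaw A B π₁ U (t + 1)) (fun x => x) (fun x => x) = _
  rw [stateLaw_succ h1, covMat_map (by fun_prop) (by fun_prop) (by fun_prop)]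
  rfl

/-- The states of the Gaussian pair are Gaussian, with the moments of the original states. -/
lemma stateMeasure_gaussian (hU : Admissible T A B π₁ U) (hπ : π₁ ≠ 0) (h1 : 1 ≤ t)
    (hT : t ≤ T) :
    stateMeasure A B (gaussianInit A B π₁ U) (gaussianPolicy A B π₁ U) t =
      π₁ Set.univ • multivariateGaussian (stateMean A B π₁ U t) (stateCov A B π₁ U t) := by
  induction t, h1 using Nat.le_induction with
  | base => rfl
  | succ t ht ih =>
    have hlt : t < T := hT
    have := isFiniteMeasure_init (ht.trans hlt.le) hU
    have := isProbabilityMeasure_jointLaw hU hπ ht hlt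
    rw [stateMeasure_succ ht, ih hlt.le, Measure.compProd_smul_left, Measure.map_smul,
      gaussianPolicy_eq hU hπ ht hlt, stateMean_eq hU hπ ht hlt, stateCov_eq hU hπ ht hlt,
      map_regression (memLp_fst_jointLaw hU hπ ht hlt) (memLp_snd_jointLaw hU hπ ht hlt),
      ← stateMean_succ ht, ← stateCov_succ ht]

/-- The controls of the Gaussian pair have the same energy as the original controls. -/
lemma lintegral_control_gaussian (hU : Admissible T A B π₁ U) (hπ : π₁ ≠ 0) (h1 : 1 ≤ t)
    (hT : t < T) :
    ∫⁻ x, ∫⁻ u, ‖u‖ₑ ^ 2 ∂(gaussianPolicy A B π₁ U t x)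
        ∂(stateMeasure A B (gaussianInit A B π₁ U) (gaussianPolicy A B π₁ U) t) =
      ∫⁻ x, ∫⁻ u, ‖u‖ₑ ^ 2 ∂(U t x) ∂(stateMeasure A B π₁ U t) := by
  have := isProbabilityMeasure_jointLaw hU hπ h1 hT
  have hX := memLp_fst_jointLaw hU hπ h1 hT
  have hY := memLp_snd_jointLaw hU hπ h1 hT
  -- With A = 0 and B = 1 the linear image is the control itself.
  have hmap := map_regression hX hY (0 : Matrix (Fin d') (Fin d) ℝ) 1
  simp only [zero_act, zero_add, act_one] at hmap
  rw [lintegral_control hU hπ h1 hT, stateMeasure_gaussian hU hπ h1 hT.le,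
    lintegral_smul_measure, smul_eq_mul,
    ← Measure.lintegral_compProd (f := fun z : E d × E d' => ‖z.2‖ₑ ^ 2) (by fun_prop),
    gaussianPolicy_eq hU hπ h1 hT, stateMean_eq hU hπ h1 hT, stateCov_eq hU hπ h1 hT,
    ← lintegral_map (f := fun u : E d' => ‖u‖ₑ ^ 2) (by fun_prop) (by fun_prop), hmap,
    lintegral_enorm_sq (memLp_multivariateGaussian _ _), lintegral_enorm_sq hY,
    integral_id_multivariateGaussian, covMat_multivariateGaussian _ (posSemidef_covMat hY)]

lemma controlCost_gaussian (hU : Admissible T A B π₁ U) (hπ : π₁ ≠ 0) :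
    controlCost T A B (gaussianInit A B π₁ U) (gaussianPolicy A B π₁ U) =
      controlCost T A B π₁ U := by
  refine Finset.sum_congr rfl fun t ht => ?_
  rw [Finset.mem_Ico] at ht
  exact lintegral_control_gaussian hU hπ ht.1 ht.2

lemma admissible_gaussian (hT : 1 ≤ T) (hU : Admissible T A B π₁ U) (hπ : π₁ ≠ 0) :
    Admissible T A B (gaussianInit A B π₁ U) (gaussianPolicy A B π₁ U) where
  markov t _ := inferInstance
  finite t ht := by
    rw [Finset.mem_Icc] at ht
    have := isFiniteMeasure_init hT hU
    rw [stateMeasure_gaussian hU hπ ht.1 ht.2]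
    exact Measure.smul_finite _ (measure_ne_top _ _)
  secondMoment t ht := by
    rw [Finset.mem_Icc] at ht
    have := isFiniteMeasure_init hT hU
    rw [stateMeasure_gaussian hU hπ ht.1 ht.2, lintegral_smul_measure, smul_eq_mul]
    exact ENNReal.mul_lt_top (measure_lt_top _ _)
      ((memLp_two_iff (by fun_prop)).mp (memLp_multivariateGaussian _ _))
  energy := by
    rw [controlCost_gaussian hU hπ]
    exact hU.energy

lemma klDiv_stateMeasure_gaussian_le (hU : Admissible T A B π₁ U) (hπ : π₁ ≠ 0) (h1 : 1 ≤ t)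
    (hT : t ≤ T) {a : ℝ} (ha : 0 < a) (m : E d) {S : Matrix (Fin d) (Fin d) ℝ}
    (hS : S.PosDef) :
    klDiv (stateMeasure A B (gaussianInit A B π₁ U) (gaussianPolicy A B π₁ U) t)
        (ENNReal.ofReal a • multivariateGaussian m S) ≤
      klDiv (stateMeasure A B π₁ U t) (ENNReal.ofReal a • multivariateGaussian m S) := by
  have := isFiniteMeasure_init (h1.trans hT) hU
  have := isProbabilityMeasure_stateLaw hU hπ h1 hT
  have hc : 0 < (π₁ Set.univ).toReal :=
    ENNReal.toReal_pos (by simpa using hπ) (measure_ne_top _ _)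
  have h := klDiv_gaussian_le (memLp_stateLaw hU hπ h1 hT) hc ha m hS
  rw [ENNReal.ofReal_toReal (measure_ne_top _ _)] at h
  rw [stateMeasure_gaussian hU hπ h1 hT, smul_stateLaw (h1.trans hT) hU hπ]
  exact h

/-! ### Expected entropies -/

/-- The residual of the regression of the control on the state, as a function on the product. -/
lemma residual_jointLaw (z : E d × E d') :
    residual (jointLaw A B π₁ U t) Prod.fst Prod.snd z = z.2 -
      ((∫ z, z.2 ∂(jointLaw A B π₁ U t)) + act (regMat (jointLaw A B π₁ U t) Prod.fst Prod.snd)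
        (z.1 - ∫ z, z.1 ∂(jointLaw A B π₁ U t))) := rfl

/-- The conditional covariance is the same for all x, so every conditional law is singular to the
same degree and has entropy −∞; the state measure is nonzero. -/
lemma expectedEntropy_gaussian_of_not_posDef (hU : Admissible T A B π₁ U) (hπ : π₁ ≠ 0)
    (h1 : 1 ≤ t) (hT : t < T)
    (hC : ¬ (residualCov (jointLaw A B π₁ U t) Prod.fst Prod.snd).PosDef) :
    expectedEntropy (stateMeasure A B (gaussianInit A B π₁ U) (gaussianPolicy A B π₁ U) t)
      (gaussianPolicy A B π₁ U t) = ⊥ := by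
  have := isProbabilityMeasure_jointLaw hU hπ h1 hT
  have hPSD := posSemidef_residualCov (memLp_fst_jointLaw hU hπ h1 hT)
    (memLp_snd_jointLaw hU hπ h1 hT)
  have hne : stateMeasure A B (gaussianInit A B π₁ U) (gaussianPolicy A B π₁ U) t ≠ 0 := by
    rw [stateMeasure_gaussian hU hπ h1 hT.le]
    simpa using ⟨hπ, IsProbabilityMeasure.ne_zero _⟩
  have hent : ∀ x, -entropy (gaussianPolicy A B π₁ U t x) = ⊤ := fun x => by
    rw [gaussianPolicy_eq hU hπ h1 hT, affineGaussianKernel_apply, entropy,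
      if_neg (not_absolutelyContinuous_multivariateGaussian _ hPSD hC), EReal.neg_bot]
  rw [expectedEntropy]
  simp_rw [hent]
  rw [eintegral_top hne, EReal.neg_top]

/-- The residual is almost surely orthogonal to a fixed v ≠ 0. Disintegrating, U(·|x) charges only
an affine hyperplane for almost every x, so its entropy is −∞. -/
lemma expectedEntropy_of_not_posDef (hU : Admissible T A B π₁ U) (hπ : π₁ ≠ 0)
    (h1 : 1 ≤ t) (hT : t < T)
    (hC : ¬ (residualCov (jointLaw A B π₁ U t) Prod.fst Prod.snd).PosDef) :
    expectedEntropy (stateMeasure A B π₁ U t) (U t) = ⊥ := by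
  have := isProbabilityMeasure_jointLaw hU hπ h1 hT
  have := hU.markov t (Finset.mem_Ico.mpr ⟨h1, hT⟩)
  have := isProbabilityMeasure_stateLaw hU hπ h1 hT.le
  have hX := memLp_fst_jointLaw hU hπ h1 hT
  have hY := memLp_snd_jointLaw hU hπ h1 hT
  have hne : stateMeasure A B π₁ U t ≠ 0 := by
    rw [smul_stateLaw (h1.trans hT.le) hU hπ]
    simpa using ⟨hπ, IsProbabilityMeasure.ne_zero _⟩
  rw [← covMat_residual hX hY] at hC
  obtain ⟨v, hv, hae⟩ := exists_ae_dotProduct_eq_zero (memLp_residual hX hY) hC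
  rw [integral_residual hX hY] at hae
  simp only [sub_zero, residual_jointLaw] at hae
  have hae' := Measure.ae_ae_of_ae_compProd (hae.filter_mono
    (jointLaw_eq_compProd hU h1 hT ▸ le_rfl :
      ae (stateLaw A B π₁ U t ⊗ₘ U t) ≤ ae (jointLaw A B π₁ U t)))
  have hent : ∀ᵐ x ∂(stateMeasure A B π₁ U t), -entropy (U t x) = ⊤ := by
    rw [smul_stateLaw (h1.trans hT.le) hU hπ]
    refine Measure.ae_smul_measure ?_ _
    filter_upwards [hae'] with x hx
    rw [entropy, if_neg (not_absolutelyContinuous_of_ae_dotProduct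
      (IsProbabilityMeasure.ne_zero _) hv hx), EReal.neg_bot]
  rw [expectedEntropy, eintegral_congr_ae hent, eintegral_top hne, EReal.neg_top]

/-- The bound h is the averaged cross-entropy of U(·|x) against the Gaussian policy at x. The
log-density is quadratic in the residual, whose mean and covariance agree for both pairs, so h is
also the Gaussian expected entropy. -/
lemma expectedEntropy_le_of_posDef (hU : Admissible T A B π₁ U) (hπ : π₁ ≠ 0)
    (h1 : 1 ≤ t) (hT : t < T)
    (hC : (residualCov (jointLaw A B π₁ U t) Prod.fst Prod.snd).PosDef) :
    ∃ h : ℝ, expectedEntropy (stateMeasure A B π₁ U t) (U t) ≤ (h : EReal) ∧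
      expectedEntropy (stateMeasure A B (gaussianInit A B π₁ U) (gaussianPolicy A B π₁ U) t)
        (gaussianPolicy A B π₁ U t) = (h : EReal) := by
  have := isProbabilityMeasure_jointLaw hU hπ h1 hT
  have := hU.markov t (Finset.mem_Ico.mpr ⟨h1, hT⟩)
  have := isProbabilityMeasure_stateLaw hU hπ h1 hT.le
  have := isFiniteMeasure_init (h1.trans hT.le) hU
  have hX := memLp_fst_jointLaw hU hπ h1 hT
  have hY := memLp_snd_jointLaw hU hπ h1 hT
  have hW := memLp_residual hX hY
  obtain ⟨M, k, hk⟩ := exists_multivariateGaussian_eq_withDensity hC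
  set C := residualCov (jointLaw A B π₁ U t) Prod.fst Prod.snd with hCdef
  let center : E d → E d' := fun x => (∫ z, z.2 ∂(jointLaw A B π₁ U t)) +
    act (regMat (jointLaw A B π₁ U t) Prod.fst Prod.snd) (x - ∫ z, z.1 ∂(jointLaw A B π₁ U t))
  let q : E d → E d' → ℝ := fun x u => k - ‖act M (u - center x)‖ ^ 2 / 2
  have hqm : ∀ x, Measurable (q x) := fun x => by fun_prop
  have hMW : Integrable (fun z => ‖act M (residual (jointLaw A B π₁ U t) Prod.fst Prod.snd z)‖ ^ 2)
      (jointLaw A B π₁ U t) := integrable_norm_sq (memLp_act M hW)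
  have hqi : Integrable (fun z : E d × E d' => q z.1 z.2) (stateLaw A B π₁ U t ⊗ₘ U t) := by
    rw [← jointLaw_eq_compProd hU h1 hT]
    exact (integrable_const k).sub (hMW.div_const 2)
  have hqv : ∫ x, ∫ u, q x u ∂(U t x) ∂(stateLaw A B π₁ U t) = k - (M * C * Mᵀ).trace / 2 := by
    rw [← Measure.integral_compProd hqi, ← jointLaw_eq_compProd hU h1 hT]
    change ∫ z, k - ‖act M (residual (jointLaw A B π₁ U t) Prod.fst Prod.snd z)‖ ^ 2 / 2
      ∂(jointLaw A B π₁ U t) = _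
    rw [integral_sub (integrable_const k) (hMW.div_const 2), integral_div,
      integral_norm_sq (memLp_act M hW), integral_act M (hW.integrable one_le_two),
      integral_residual hX hY, covMat_act_left _ hW (memLp_act M hW), covMat_act_right _ hW hW,
      covMat_residual hX hY]
    simp [Matrix.mul_assoc, hCdef]
  have hent : ∀ x, entropy (gaussianPolicy A B π₁ U t x) =
      ((-(k - (M * C * Mᵀ).trace / 2) : ℝ) : EReal) := fun x => by
    have hG := memLp_multivariateGaussian (center x) C
    have hi := (integrable_norm_sq_act hG M (center x)).div_const 2
    have hqG : Integrable (q x) (multivariateGaussian (center x) C) := (integrable_const k).sub hi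
    rw [gaussianPolicy_eq hU hπ h1 hT, affineGaussianKernel_apply]
    change entropy (multivariateGaussian (center x) C) = _
    rw [entropy_withDensity (hqm x) (hk (center x)) hqG, integral_sub (integrable_const k) hi,
      integral_div, integral_norm_sq_act hG, integral_id_multivariateGaussian,
      covMat_multivariateGaussian _ hC.posSemidef]
    simp
  refine ⟨-((π₁ Set.univ).toReal * (k - (M * C * Mᵀ).trace / 2)), ?_, ?_⟩
  · rw [expectedEntropy, EReal.coe_neg, EReal.neg_le_neg_iff, ← hqv, ← smul_eq_mul,
      ← integral_smul_measure, ← smul_stateLaw (h1.trans hT.le) hU hπ]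
    have hi : Integrable (fun x => ∫ u, q x u ∂(U t x)) (stateMeasure A B π₁ U t) := by
      rw [smul_stateLaw (h1.trans hT.le) hU hπ]
      exact (Integrable.integral_compProd
        (κ := Kernel.const Unit (stateLaw A B π₁ U t)) (η := Kernel.prodMkLeft Unit (U t))
        (a := ()) hqi).smul_measure (measure_ne_top _ _)
    rw [← eintegral_coe hi]
    refine eintegral_mono_ae ?_
    rw [smul_stateLaw (h1.trans hT.le) hU hπ]
    refine Measure.ae_smul_measure ?_ _
    -- Fubini gives integrability of q(x, ·) under U(·|x) only for almost every x, which suffices.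
    filter_upwards [((Measure.integrable_compProd_iff hqi.aestronglyMeasurable).mp hqi).1]
      with x hx
    have h := entropy_le (hqm x) (hk (center x)) hx
    rwa [EReal.coe_neg, ← EReal.neg_le_neg_iff, neg_neg] at h
  · rw [expectedEntropy]
    simp_rw [hent, ← EReal.coe_neg, neg_neg]
    rw [stateMeasure_gaussian hU hπ h1 hT.le]
    have : IsFiniteMeasure (π₁ Set.univ •
        multivariateGaussian (stateMean A B π₁ U t) (stateCov A B π₁ U t)) :=
      Measure.smul_finite _ (measure_ne_top _ _)
    rw [eintegral_coe (integrable_const _), integral_smul_measure, integral_const]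
    simp

lemma expectedEntropy_le (hU : Admissible T A B π₁ U) (hπ : π₁ ≠ 0) (h1 : 1 ≤ t) (hT : t < T) :
    expectedEntropy (stateMeasure A B π₁ U t) (U t) ≤
        expectedEntropy
          (stateMeasure A B (gaussianInit A B π₁ U) (gaussianPolicy A B π₁ U) t)
          (gaussianPolicy A B π₁ U t) ∧
      expectedEntropy (stateMeasure A B (gaussianInit A B π₁ U) (gaussianPolicy A B π₁ U) t)
        (gaussianPolicy A B π₁ U t) < ⊤ := by
  by_cases hC : (residualCov (jointLaw A B π₁ U t) Prod.fst Prod.snd).PosDef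
  · obtain ⟨h, hle, heq⟩ := expectedEntropy_le_of_posDef hU hπ h1 hT hC
    rw [heq]
    exact ⟨hle, EReal.coe_lt_top h⟩
  · rw [expectedEntropy_of_not_posDef hU hπ h1 hT hC,
      expectedEntropy_gaussian_of_not_posDef hU hπ h1 hT hC]
    exact ⟨le_rfl, bot_lt_top⟩

end GaussianPair

end UDC

theorem mainTheorem10 (d d' T : ℕ) (hd : 1 ≤ d) (hd' : 1 ≤ d') (hT : 1 ≤ T)
    (A : Matrix (Fin d) (Fin d) ℝ) (hA : IsUnit A.det) (B : Matrix (Fin d) (Fin d') ℝ)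
    (γ ε : ℝ) (hγ : 0 < γ) (hε : 0 < ε)
    (cα cβ : ℝ) (hcα : 0 < cα) (hcβ : 0 < cβ) (mα mβ : UDC.E d)
    (Sα Sβ : Matrix (Fin d) (Fin d) ℝ) (hSα : Sα.PosDef) (hSβ : Sβ.PosDef)
    (α β : Measure (UDC.E d))
    (hα : α = ENNReal.ofReal cα • multivariateGaussian mα Sα)
    (hβ : β = ENNReal.ofReal cβ • multivariateGaussian mβ Sβ)
    (π₁ : Measure (UDC.E d)) (U : ℕ → Kernel (UDC.E d) (UDC.E d'))
    (hU : UDC.Admissible T A B π₁ U) (hπ₁ : π₁ ≠ 0) :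
    UDC.Admissible T A B (UDC.gaussianInit A B π₁ U) (UDC.gaussianPolicy A B π₁ U) ∧
    (∀ t ∈ Finset.Ico 1 T,
      UDC.expectedEntropy (UDC.stateMeasure A B π₁ U t) (U t) ≤
        UDC.expectedEntropy
          (UDC.stateMeasure A B (UDC.gaussianInit A B π₁ U) (UDC.gaussianPolicy A B π₁ U) t)
          (UDC.gaussianPolicy A B π₁ U t) ∧
      UDC.expectedEntropy
          (UDC.stateMeasure A B (UDC.gaussianInit A B π₁ U) (UDC.gaussianPolicy A B π₁ U) t)
          (UDC.gaussianPolicy A B π₁ U t) < ⊤) ∧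
    UDC.maxEntObjective T A B γ ε α β (UDC.gaussianInit A B π₁ U) (UDC.gaussianPolicy A B π₁ U) ≤
      UDC.maxEntObjective T A B γ ε α β π₁ U := by
  have hent := fun t (ht : t ∈ Finset.Ico 1 T) =>
    UDC.expectedEntropy_le hU hπ₁ (Finset.mem_Ico.mp ht).1 (Finset.mem_Ico.mp ht).2
  refine ⟨UDC.admissible_gaussian hT hU hπ₁, hent, ?_⟩
  -- Monotonicity of `EReal` subtraction lets costs and entropies be compared separately, even at
  -- infinite values.
  refine EReal.sub_le_sub ?_ ?_
  · rw [EReal.coe_ennreal_le_coe_ennreal_iff, UDC.udcObjective, UDC.udcObjective,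
      UDC.controlCost_gaussian hU hπ₁, hα, hβ]
    gcongr
    · exact UDC.klDiv_stateMeasure_gaussian_le hU hπ₁ le_rfl hT hcα mα hSα
    · exact UDC.klDiv_stateMeasure_gaussian_le hU hπ₁ hT le_rfl hcβ mβ hSβ
  · exact mul_le_mul_of_nonneg_left (Finset.sum_le_sum fun t ht => (hent t ht).1)
      (EReal.coe_nonneg.mpr hε.le)
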